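/- **Setting.** Let $U(sl_2)$ be the universal enveloping algebra of $sl_2(\mathbb C)$. Let $a_1,a_2,a_3$ and $b_1,b_2,b_3$ be bases of $sl_2(\mathbb C)$ that are dual for the form $\mathrm{Tr}(xy)$ (trace of $2\times 2$ matrices), e.g. $(e,h,f)$ and $(f,h/2,e)$, and let $c=\sum_i a_ib_i\in U(sl_2)$ be the Casimir element. *Weight of a chord diagram.* Let $D$ be a chord diagram on an oriented circle with a base point away from the endpoints of the chords. For each labelling of the chords by $1,2,3$, put $a_i$ at the first and $b_i$ at the second endpoint of each chord labelled $i$, and multiply these elements in $U(sl_2)$ in the order in which they are met along the circle from the base point. $W(D)$ is the sum of these products over all labellings. *Trivalent diagrams.* A trivalent diagram is a connected graph (loops and multiple edges allowed) with trivalent vertices and a distinguished oriented circle, with a cyclic order of the three half-edges at each vertex off the circle, considered up to isomorphism. Let $\mathcal T$ be the complex vector space spanned by trivalent diagrams modulo the relations STU: $S=T-U$, where $S$ has a vertex $v$ off the circle joined by an edge to the circle; in $T$ that edge and $v$ are removed and the two other half-edges at $v$ are attached to two consecutive points of the circle at its place, and in $U$ they are attached in the opposite order. (With the circle drawn from left to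 right, the graph above it, and the cyclic order at $v$ counterclockwise, these two edges do not cross in $T$ and cross in $U$.) Every trivalent diagram is, modulo STU, a linear combination of chord diagrams (the trivalent diagrams without vertices off the circle), and $W$ is defined on $\mathcal T$ by applying $W$ to such a combination; it does not depend on the combination chosen. *Uni-trivalent diagrams.* For a graph $G$ with univalent vertices (legs) and trivalent vertices, with a cyclic order of the half-edges at each trivalent vertex and with a leg in each component, $W(G)$ is $W$ of the average in $\mathcal T$ of all trivalent diagrams obtained by placing the legs of $G$ along the circle. For $n\ge 1$, the wheel $w_{2n}$ is the planar uni-trivalent graph consisting of a cycle through $2n$ trivalent vertices with one leg pointing outwards at each of them, with the counterclockwise cyclic orders. *The sum of chord diagrams.* Fix $2n$ points $p_1,\dots,p_{2n}$ in this order on the circle. For a permutation $\sigma\in S_{2n}$, let $D(\sigma)$ be the chord diagram with the $n$ chords joining $p_{\sigma(2i-1)}$ and $p_{\sigma(2i)}$, $i=1,\dots,n$. *Shifted Bernoulli polynomials.* Let $B_m(x)$ be the Bernoulli polynomials, $\frac{ze^{zx}}{e^z-1}=\sum_{m\ge 0}B_m(x)\frac{z^m}{m!}$, and let $q_n$ be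 the polynomial determined by $$q_n\Big(\frac{x^2-1}{2}\Big)=\frac{2}{(2n+1)!}\,\frac{B_{2n+1}\big(\frac{1+x}{2}\big)}{x}.$$ **Theorem 4.1.** For every integer $n\ge 1$, $$W(w_{2n})=2^{2n+1}\,(2n+1)!\;q_n(c)\qquad\text{and}\qquad \sum_{\sigma\in S_{2n}}W(D(\sigma))=2^n\,(2n)!\,(2n+1)!\;q_n(c)$$ in $U(sl_2)$, where in the first equation it is part of the claim that $W(w_{2n})$ is well defined. -/

import Mathlib

open scoped Nat

namespace SlTwoWheels

noncomputable section

/-! ### The Lie algebra, the trace form, dual bases and the Casimir element -/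

/-- The Lie algebra `sl_2(ℂ)` of traceless complex `2 × 2` matrices. -/
abbrev SlTwo : Type := LieAlgebra.SpecialLinear.sl (Fin 2) ℂ

/-- The universal enveloping algebra `U(sl_2)`. -/
abbrev USlTwo : Type := UniversalEnvelopingAlgebra ℂ SlTwo

/-- The ad-invariant form `Tr(xy)`, the trace in the standard two-dimensional representation. -/
def traceForm (x y : SlTwo) : ℂ := Matrix.trace (x.val * y.val)

def slE : SlTwo := ⟨!![0, 1; 0, 0], by
  simp [LieAlgebra.SpecialLinear.sl, Matrix.trace_fin_two]⟩

def slH : SlTwo := ⟨!![1, 0; 0, -1], by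
  simp [LieAlgebra.SpecialLinear.sl, Matrix.trace_fin_two]⟩

def slF : SlTwo := ⟨!![0, 0; 1, 0], by
  simp [LieAlgebra.SpecialLinear.sl, Matrix.trace_fin_two]⟩

/-- The basis `a₁, a₂, a₃ = e, h, f` of `sl_2`. -/
def basisA : Fin 3 → SlTwo := ![slE, slH, slF]

/-- The basis `b₁, b₂, b₃ = f, h/2, e` of `sl_2`, dual to `a₁, a₂, a₃` for the trace form. -/
def basisB : Fin 3 → SlTwo := ![slF, (1 / 2 : ℂ) • slH, slE]

theorem traceForm_basisA_basisB (i j : Fin 3) :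
    traceForm (basisA i) (basisB j) = if i = j then 1 else 0 := by
  fin_cases i <;> fin_cases j <;>
    simp [traceForm, basisA, basisB, slE, slH, slF, Matrix.trace_fin_two]
  norm_num

theorem eq_sum_traceForm_smul (x : SlTwo) :
    x = ∑ i, traceForm x (basisB i) • basisA i := by
  have hx : x.val 0 0 + x.val 1 1 = 0 := by
    have h := x.property
    simpa [LieAlgebra.SpecialLinear.sl, Matrix.trace_fin_two] using h
  apply Subtype.ext
  ext i j
  fin_cases i <;> fin_cases j <;>
    simp [Fin.sum_univ_three, traceForm, basisA, basisB, slE, slH, slF, Matrix.trace_fin_two,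
      Matrix.mul_apply]
  all_goals linear_combination (1 / 2 : ℂ) * hx

/-- The quadratic Casimir element `c = ∑ᵢ aᵢ bᵢ` of the trace form. -/
def casimir : USlTwo :=
  ∑ i, UniversalEnvelopingAlgebra.ι ℂ (basisA i) * UniversalEnvelopingAlgebra.ι ℂ (basisB i)

/-! ### Chord diagrams and the weight system on them -/

/-- A chord diagram on an oriented circle with `m` marked points. The points are numbered
`0, …, m - 1` in the order in which they are met when one walks around the circle from a base
point; `mate i` is the other end of the chord that ends at `i` (so there are `m / 2` chords). -/
structure ChordDiagram (m : ℕ) where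
  mate : Fin m → Fin m
  mate_mate : ∀ i, mate (mate i) = i
  mate_ne : ∀ i, mate i ≠ i

/-- The `sl_2` weight `W(D)` of a chord diagram. A labelling of the chords is a map `l` on the
marked points which takes the same value at both ends of each chord. The first endpoint of a
chord labelled `i` carries `aᵢ`, the second one `bᵢ`; the word read along the circle is summed
over all labellings. -/
def chordWeight {m : ℕ} (D : ChordDiagram m) : USlTwo :=
  ∑ l : Fin m → Fin 3 with ∀ i, l (D.mate i) = l i,
    (List.ofFn fun i : Fin m =>
      UniversalEnvelopingAlgebra.ι ℂ
        (if i < D.mate i then basisA (l i) else basisB (l i))).prod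

/-- The pairing `{2i, 2i + 1}` of `0, …, 2n - 1`. -/
def standardMate (n : ℕ) (i : Fin (2 * n)) : Fin (2 * n) :=
  ⟨if i.val % 2 = 0 then i.val + 1 else i.val - 1, by have := i.isLt; split_ifs <;> omega⟩

theorem standardMate_standardMate (n : ℕ) (i : Fin (2 * n)) :
    standardMate n (standardMate n i) = i := by
  apply Fin.ext
  simp only [standardMate]
  split_ifs <;> omega

theorem standardMate_ne (n : ℕ) (i : Fin (2 * n)) : standardMate n i ≠ i := by
  intro h
  have h2 := congrArg Fin.val h
  simp only [standardMate] at h2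
  split_ifs at h2 <;> omega

/-- The chord diagram `D(σ)`: its chords join the points number `σ(2i)` and `σ(2i + 1)`,
`0 ≤ i < n`. -/
def permChordDiagram (n : ℕ) (σ : Equiv.Perm (Fin (2 * n))) : ChordDiagram (2 * n) where
  mate i := σ (standardMate n (σ.symm i))
  mate_mate i := by simp [standardMate_standardMate]
  mate_ne i h := standardMate_ne n (σ.symm i) (by
    apply σ.injective
    simpa using h)

/-! ### Uni-trivalent and trivalent diagrams -/

/-- Half-edges of a graph with `k` trivalent vertices and `m` univalent ones: three at every
trivalent vertex `v`, namely `(v, 0), (v, 1), (v, 2)` in their cyclic order, and one at each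
univalent vertex. -/
abbrev HalfEdge (k m : ℕ) : Type := (Fin k × Fin 3) ⊕ Fin m

/-- A uni-trivalent diagram with `k` trivalent vertices and `m` (numbered) legs: the half-edges
are glued in pairs into edges, and each connected component has a leg. Loops and multiple
edges are allowed.

The same data is a trivalent diagram with `k` vertices off the distinguished circle and `m`
vertices on it, when the univalent vertices `0, …, m - 1` are put on the oriented circle in this
order; the last condition says that the graph together with the circle is connected. -/
structure Diagram (k m : ℕ) where
  edge : HalfEdge k m → HalfEdge k m
  edge_edge : ∀ h, edge (edge h) = h
  edge_ne : ∀ h, edge h ≠ h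
  reach : ∀ v : Fin k, ∃ w : Fin k,
    Relation.ReflTransGen
      (fun u u' : Fin k => ∃ i j, edge (Sum.inl (u, i)) = Sum.inl (u', j)) v w ∧
    ∃ i j, edge (Sum.inl (w, i)) = Sum.inr j

/-- The diagram obtained by renumbering the legs by `σ`: leg `j` becomes number `σ j`. -/
def Diagram.permuteLegs {k m : ℕ} (D : Diagram k m) (σ : Equiv.Perm (Fin m)) :
    Diagram k m where
  edge h := Sum.map id σ (D.edge (Sum.map id σ.symm h))
  edge_edge h := by
    have h1 : ∀ x : HalfEdge k m, Sum.map id σ.symm (Sum.map id σ x) = x := by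
      rintro (x | x) <;> simp
    have h2 : ∀ x : HalfEdge k m, Sum.map id σ (Sum.map id σ.symm x) = x := by
      rintro (x | x) <;> simp
    rw [h1, D.edge_edge, h2]
  edge_ne h hh := by
    have h1 : ∀ x : HalfEdge k m, Sum.map id σ.symm (Sum.map id σ x) = x := by
      rintro (x | x) <;> simp
    apply D.edge_ne (Sum.map id σ.symm h)
    conv_rhs => rw [← hh]
    rw [h1]
  reach v := by
    obtain ⟨w, hw, i, j, hij⟩ := D.reach v
    refine ⟨w, Relation.ReflTransGen.mono ?_ _ _ hw, i, σ j, by simp [hij]⟩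
    rintro u u' ⟨a, b, hab⟩
    exact ⟨a, b, by simp [hab]⟩

/-- A chord diagram, as a trivalent diagram without vertices off the circle. -/
def ChordDiagram.toDiagram {m : ℕ} (D : ChordDiagram m) : Diagram 0 m where
  edge := Sum.map id D.mate
  edge_edge h := by
    rcases h with ⟨v, _⟩ | i
    · exact v.elim0
    · simp [D.mate_mate]
  edge_ne h := by
    rcases h with ⟨v, _⟩ | i
    · exact v.elim0
    · simpa using D.mate_ne i
  reach v := v.elim0

/-- Isomorphism of trivalent diagrams: a renumbering `π` of the vertices off the circle, a
rotation `r v` of the three half-edges at each of them, and a change of the base point of the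
circle (a rotation by `s`). -/
def Diagram.Iso {k m : ℕ} (D D' : Diagram k m) : Prop :=
  ∃ (π : Equiv.Perm (Fin k)) (r : Fin k → Fin 3) (s : ℕ),
    let ψ : HalfEdge k m → HalfEdge k m :=
      Sum.map (fun p => (π p.1, p.2 + r p.1)) ((finRotate m ^ s : Equiv.Perm (Fin m)))
    ∀ h, D'.edge (ψ h) = ψ (D.edge h)

/-- For diagrams `S` and `T` of the STU relation: how the half-edges of `T` are found in `S`. The
points `0` and `1` of the circle of `T` are replaced by the half-edges `2` and `1` at the
additional vertex of `S`; the other points of the circle are shifted by one. -/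
def stuHalfEdge {k m : ℕ} : HalfEdge k (m + 2) → HalfEdge (k + 1) (m + 1)
  | Sum.inl (v, i) => Sum.inl (v.castSucc, i)
  | Sum.inr j =>
    Fin.cases (Sum.inl (Fin.last k, 2))
      (fun j' => Fin.cases (Sum.inl (Fin.last k, 1)) (fun j'' => Sum.inr j''.succ) j') j

/-- `S` arises from `T` by merging the first two points of the circle into a trivalent vertex,
joined by a new edge to the first point of the circle of `S`. The cyclic order at this vertex is:
the new edge, the edge that ended at point `1`, the edge that ended at point `0`; this is the
counterclockwise order if the circle is drawn from left to right with the graph above it. -/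
def IsMerge {k m : ℕ} (T : Diagram k (m + 2)) (S : Diagram (k + 1) (m + 1)) : Prop :=
  (∀ h, S.edge (stuHalfEdge h) = stuHalfEdge (T.edge h)) ∧
    S.edge (Sum.inl (Fin.last k, 0)) = Sum.inr 0

/-- Formal linear combinations of trivalent diagrams. -/
abbrev FreeTrivalent : Type := (Σ k : ℕ, Σ m : ℕ, Diagram k m) →₀ ℂ

def freeMk {k m : ℕ} (D : Diagram k m) : FreeTrivalent := Finsupp.single ⟨k, m, D⟩ 1

/-- The span of all `D - D'` with `D`, `D'` isomorphic and of all `S - (T - U)` with `S`, `T`, `U`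
as in the STU relation. By a change of the base point, it suffices to take this relation
at the first two points of the circle. -/
def trivalentRelations : Submodule ℂ FreeTrivalent :=
  Submodule.span ℂ
    ({x | ∃ (k m : ℕ) (D D' : Diagram k m), D.Iso D' ∧ x = freeMk D - freeMk D'} ∪
     {x | ∃ (k m : ℕ) (T : Diagram k (m + 2)) (S : Diagram (k + 1) (m + 1)),
        IsMerge T S ∧
        x = freeMk S - (freeMk T - freeMk (T.permuteLegs (Equiv.swap 0 1)))})

/-- The space `𝒯` of trivalent diagrams modulo STU, with scalars extended to `ℂ`, where the
weight system takes its values. -/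
abbrev Trivalent : Type := FreeTrivalent ⧸ trivalentRelations

def Diagram.toTrivalent {k m : ℕ} (D : Diagram k m) : Trivalent :=
  trivalentRelations.mkQ (freeMk D)

/-- The map from uni-trivalent to trivalent diagrams: the average of all ways of placing the legs
along the circle. -/
def Diagram.average {k m : ℕ} (D : Diagram k m) : Trivalent :=
  ((m ! : ℂ)⁻¹) • ∑ σ : Equiv.Perm (Fin m), (D.permuteLegs σ).toTrivalent

/-! ### The weight system on trivalent and uni-trivalent diagrams -/

/-- Formal linear combinations of chord diagrams. -/
abbrev FreeChord : Type := (Σ m : ℕ, ChordDiagram m) →₀ ℂ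

/-- The linear extension of `W` to combinations of chord diagrams. -/
def chordCombinationWeight : FreeChord →ₗ[ℂ] USlTwo :=
  Finsupp.linearCombination ℂ fun D => chordWeight D.2

/-- The class in `𝒯` of a combination of chord diagrams. -/
def chordCombinationClass : FreeChord →ₗ[ℂ] Trivalent :=
  Finsupp.linearCombination ℂ fun D => D.2.toDiagram.toTrivalent

/-- The value of the weight system on `t ∈ 𝒯` is `u`. The weight system on `𝒯` is induced by the
one on chord diagrams: express `t` modulo STU as a linear combination of chord diagrams and apply
`W` to it. The definition asks that `t` has such an expression and that all of its expressions
give the same value `u`. -/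
def HasWeight (t : Trivalent) (u : USlTwo) : Prop :=
  (∃ a : FreeChord, chordCombinationClass a = t) ∧
    ∀ a : FreeChord, chordCombinationClass a = t → chordCombinationWeight a = u

/-- The value of the weight system on the uni-trivalent diagram `D` is `u`. -/
def Diagram.HasWeight {k m : ℕ} (D : Diagram k m) (u : USlTwo) : Prop :=
  SlTwoWheels.HasWeight D.average u

/-! ### Wheels -/

/-- The half-edge gluing of the wheel with `m` legs. The trivalent vertices `0, …, m - 1` stand
counterclockwise on the rim; at each of them, the half-edges `0`, `1`, `2` lead to its leg, to the
next vertex and to the previous vertex: the counterclockwise order in the plane. -/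
def wheelEdge (m : ℕ) : HalfEdge m m → HalfEdge m m
  | Sum.inl (v, 0) => Sum.inr v
  | Sum.inl (v, 1) => Sum.inl (finRotate m v, 2)
  | Sum.inl (v, 2) => Sum.inl ((finRotate m).symm v, 1)
  | Sum.inr v => Sum.inl (v, 0)

/-- The wheel `w_m` with `m` legs. -/
def wheel (m : ℕ) : Diagram m m where
  edge := wheelEdge m
  edge_edge h := by
    rcases h with ⟨v, i⟩ | v
    · fin_cases i
      · rfl
      · exact congrArg (fun u => Sum.inl (u, 1)) ((finRotate m).symm_apply_apply v)
      · exact congrArg (fun u => Sum.inl (u, 2)) ((finRotate m).apply_symm_apply v)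
    · rfl
  edge_ne h := by
    rcases h with ⟨v, i⟩ | v
    · fin_cases i <;> simp [wheelEdge]
    · simp [wheelEdge]
  reach v := ⟨v, Relation.ReflTransGen.refl, 0, v, rfl⟩

/-! ### Shifted Bernoulli polynomials -/

/-- The Bernoulli polynomial `B_n(x)`, with complex coefficients. -/
def bernoulliPoly (n : ℕ) : Polynomial ℂ :=
  (Polynomial.bernoulli n).map (algebraMap ℚ ℂ)

open Polynomial in
/-- The condition `q((x² - 1)/2) = (2 / (2n+1)!) · B_{2n+1}((1 + x)/2) / x`, multiplied by `x`. -/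
def IsShiftedBernoulli (n : ℕ) (q : Polynomial ℂ) : Prop :=
  X * q.comp (C (1 / 2) * (X ^ 2 - 1)) =
    C (2 / ((2 * n + 1)! : ℂ)) * (bernoulliPoly (2 * n + 1)).comp (C (1 / 2) * (1 + X))

open Polynomial in
theorem exists_comp_of_odd (p : Polynomial ℂ) (hp : p.comp (-X) = -p) :
    ∃ q : Polynomial ℂ, X * q.comp (C (1 / 2) * (X ^ 2 - 1)) = p := by
  have heven : ∀ i, p.coeff (2 * i) = 0 := by
    intro i
    have h := congrArg (fun r : Polynomial ℂ => r.coeff (2 * i)) hp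
    have h2 : (p.comp (-X)).coeff (2 * i) = p.coeff (2 * i) := by
      have h3 : (-X : ℂ[X]) = C (-1) * X := by simp
      rw [h3, comp_C_mul_X_coeff]
      simp [pow_mul]
    simp only [h2, coeff_neg] at h
    linear_combination (1 / 2 : ℂ) * h
  have hsum : ∀ (f : ℕ → ℂ[X]) (M : ℕ), (∀ i, f (2 * i) = 0) →
      ∑ j ∈ Finset.range (2 * M), f j = ∑ i ∈ Finset.range M, f (2 * i + 1) := by
    intro f M hf
    induction M with
    | zero => simp
    | succ M ih =>
      rw [show 2 * (M + 1) = 2 * M + 1 + 1 by ring, Finset.sum_range_succ, Finset.sum_range_succ,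
        ih, hf, add_zero, Finset.sum_range_succ]
  refine ⟨∑ i ∈ Finset.range (p.natDegree + 1), C (p.coeff (2 * i + 1)) * (C 2 * X + 1) ^ i, ?_⟩
  have hX : (C 2 * (C (1 / 2) * (X ^ 2 - 1)) + 1 : ℂ[X]) = X ^ 2 := by
    rw [← mul_assoc, ← C_mul]
    norm_num
  conv_rhs => rw [p.as_sum_range_C_mul_X_pow' (n := 2 * (p.natDegree + 1)) (by omega)]
  rw [hsum _ _ (fun i => by simp [heven i]), sum_comp, Finset.mul_sum]
  refine Finset.sum_congr rfl fun i _ => ?_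
  rw [mul_comp, C_comp, pow_comp, add_comp, mul_comp, C_comp, X_comp, one_comp, hX]
  ring

open Polynomial in
theorem exists_isShiftedBernoulli (n : ℕ) : ∃ q, IsShiftedBernoulli n q := by
  apply exists_comp_of_odd
  have h1 : ((C (1 / 2) * (1 + X) : ℂ[X])).comp (-X) =
      (1 - X : ℂ[X]).comp (C (1 / 2) * (1 + X)) := by
    simp only [mul_comp, C_comp, add_comp, one_comp, X_comp, sub_comp]
    have h2 : (1 : ℂ[X]) = C (1 / 2) * 2 := by
      rw [show (2 : ℂ[X]) = C 2 from (map_ofNat C 2).symm, ← C_mul]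
      norm_num
    linear_combination -h2
  have h3 : (bernoulliPoly (2 * n + 1)).comp (1 - X) = -bernoulliPoly (2 * n + 1) := by
    have h4 := congrArg (fun r : ℚ[X] => r.map (algebraMap ℚ ℂ))
      (Polynomial.bernoulli_comp_one_sub_X (2 * n + 1))
    beta_reduce at h4
    rw [Polynomial.map_comp] at h4
    simpa [bernoulliPoly, pow_succ, pow_mul] using h4
  rw [mul_comp, C_comp, comp_assoc, h1, ← comp_assoc, h3]
  simp

open Polynomial in
theorem isShiftedBernoulli_unique {n : ℕ} {q q' : Polynomial ℂ} (h : IsShiftedBernoulli n q)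
    (h' : IsShiftedBernoulli n q') : q = q' := by
  have h1 : (X : ℂ[X]) * (q - q').comp (C (1 / 2) * (X ^ 2 - 1)) = 0 := by
    rw [sub_comp, mul_sub, h, h', sub_self]
  have h2 := (mul_eq_zero.1 h1).resolve_left X_ne_zero
  rcases comp_eq_zero_iff.1 h2 with h3 | ⟨_, h4⟩
  · exact sub_eq_zero.1 h3
  · have h5 := congrArg (fun r : ℂ[X] => r.coeff 2) h4
    simp [coeff_one] at h5

/-- The shifted Bernoulli polynomial `q_n`. -/
def shiftedBernoulli (n : ℕ) : Polynomial ℂ := (exists_isShiftedBernoulli n).choose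

theorem shiftedBernoulli_spec (n : ℕ) : IsShiftedBernoulli n (shiftedBernoulli n) :=
  (exists_isShiftedBernoulli n).choose_spec

end

end SlTwoWheels

/-! In an orthonormal basis for the trace form, `W` extends from chord diagrams to all trivalent
diagrams as a state sum: label the edges by basis elements, put a structure constant at every
trivalent vertex, and read a word in $U(sl_2)$ along the circle. STU then becomes the commutation
relation of the generators (`IsMerge.weight_eq`). By the Jacobi identity and the antisymmetry of the
structure constants, the tensor of a diagram is invariant (`Diagram.contract_act`); hence the state
sum is central, and it does not depend on the base point. So it descends to $\mathcal T$, agrees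
there with the weight of chord diagrams, and is determined by it because STU removes the vertices
off the circle one at a time.

Averaging over the placements of the legs symmetrizes a tensor, and a symmetrized tensor is
determined by its polynomial function (`sum_perm_eq_of_eval_eq`). For the wheel this function is the
trace of the $2n$-th power of a multiple of the cross product with $y$, namely $2^{n+1}(y\cdot
y)^n$; for the pairing of the points it is $(y\cdot y)^n$. Thus $W(w_{2n})$ is $2^{n+1}/(2n)!$ times
the sum of chord diagrams (`trivalentWeight_average_wheel`), and only that sum has to be computed.

The sum is central, so it acts by a scalar on the representation of dimension $d+1$, and the scalar
follows from the trace. The trace of the $2n$-th power of $\sum_a y_ax_a$ is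
$2^{-n}\sum_{j=0}^{d}(d-2j)^{2n}\,(y\cdot y)^n$. So by the same symmetrization principle the trace
of the chord sum is this constant times the full contraction of the symmetrized $n$-th power of the
metric with that power; the contraction is $\Delta^n r^n=(2n+1)!$ for $r=x_1^2+x_2^2+x_3^2$. The sum
over the weights is a value of $B_{2n+1}$ by telescoping, and $c$ acts by $((d+1)^2-1)/2$, which is
the substitution in the definition of $q_n$. The two sides agree on all these representations, hence
in $U(sl_2)$ (`eq_zero_of_uRep`). -/

namespace SlTwoWheels

noncomputable section

/-! ### Words and their sums -/

section Words

variable {ι A : Type*}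

/-- The product `x (p 0) * x (p 1) * ⋯` in a monoid. -/
def word [Monoid A] (x : ι → A) {m : ℕ} (p : Fin m → ι) : A :=
  (List.ofFn fun i => x (p i)).prod

theorem word_zero [Monoid A] (x : ι → A) (p : Fin 0 → ι) : word x p = 1 := by
  simp [word]

theorem word_succ [Monoid A] (x : ι → A) {m : ℕ} (p : Fin (m + 1) → ι) :
    word x p = x (p 0) * word x (fun i => p i.succ) := by
  simp [word, List.ofFn_succ]

theorem word_castSucc [Monoid A] (x : ι → A) {m : ℕ} (p : Fin (m + 1) → ι) :
    word x p = word x (fun i => p i.castSucc) * x (p (Fin.last m)) := by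
  rw [word, List.ofFn_succ_last, List.prod_append, List.prod_singleton, word]

theorem word_cons [Monoid A] (x : ι → A) {m : ℕ} (a : ι) (p : Fin m → ι) :
    word x (Fin.cons a p : Fin (m + 1) → ι) = x a * word x p := by
  simp [word_succ]

theorem word_eq_prod [CommMonoid A] (x : ι → A) {m : ℕ} (p : Fin m → ι) :
    word x p = ∏ i, x (p i) := by
  simp [word, List.prod_ofFn]

/-- The labellings of `2n` points which are constant on the pairs `{2i, 2i + 1}`. -/
def pairDelta [DecidableEq ι] (n : ℕ) (p : Fin (2 * n) → ι) : ℂ :=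
  if ∀ i, p (standardMate n i) = p i then 1 else 0

theorem pairDelta_cons [DecidableEq ι] (n : ℕ) (a b : ι) (p : Fin (2 * n) → ι) :
    pairDelta (n + 1) (Fin.cons a (Fin.cons b p : Fin (2 * n + 1) → ι)) =
      if a = b then pairDelta n p else 0 := by
  have h0 : standardMate (n + 1) 0 = Fin.succ 0 := by
    apply Fin.ext; simp [standardMate]
  have h1 : standardMate (n + 1) (Fin.succ 0) = 0 := by
    apply Fin.ext
    rfl
  have h2 : ∀ i : Fin (2 * n), standardMate (n + 1) i.succ.succ =
      (standardMate n i).succ.succ := by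
    intro i; apply Fin.ext; simp only [standardMate, Fin.val_succ]
    split_ifs <;> omega
  have key : (∀ i, (Fin.cons a (Fin.cons b p : Fin (2 * n + 1) → ι) : Fin (2 * n + 2) → ι)
      (standardMate (n + 1) i) = (Fin.cons a (Fin.cons b p : Fin (2 * n + 1) → ι) :
        Fin (2 * n + 2) → ι) i) ↔ a = b ∧ ∀ i, p (standardMate n i) = p i := by
    constructor
    · intro h
      refine ⟨?_, fun i => ?_⟩
      · have := h (Fin.succ 0); rw [h1] at this; simpa using this
      · have := h i.succ.succ; rw [h2] at this; simpa using this
    · rintro ⟨rfl, h⟩ i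
      refine Fin.cases ?_ (fun i => Fin.cases ?_ (fun i => ?_) i) i
      · rw [h0]; simp
      · rw [h1]; simp
      · rw [h2]; simpa using h i
  unfold pairDelta
  by_cases hab : a = b
  · simp only [hab, if_true]
    exact if_congr (by simpa [hab] using key) rfl rfl
  · rw [if_neg hab]
    exact if_neg fun h => hab (key.1 h).1

variable [Fintype ι]

theorem sum_cons {M : Type*} [AddCommMonoid M] {m : ℕ} (g : (Fin (m + 1) → ι) → M) :
    ∑ p, g p = ∑ a, ∑ p : Fin m → ι, g (Fin.cons a p) := by
  rw [← Fintype.sum_prod_type']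
  exact (Fintype.sum_equiv (Fin.consEquiv fun _ => ι) _ _ fun _ => rfl).symm

/-- Expansion of an ordered product of sums. -/
theorem prod_ofFn_sum [Semiring A] {m : ℕ} (g : Fin m → ι → A) :
    (List.ofFn fun i => ∑ a, g i a).prod =
      ∑ p : Fin m → ι, (List.ofFn fun i => g i (p i)).prod := by
  induction m with
  | zero => simp
  | succ m ih =>
    rw [sum_cons, List.ofFn_succ, List.prod_cons, ih, Finset.sum_mul_sum]
    simp [List.ofFn_succ]

theorem prod_ofFn_smul {R : Type*} [CommSemiring R] [Semiring A] [Algebra R A] {m : ℕ}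
    (c : Fin m → R) (g : Fin m → A) :
    (List.ofFn fun i => c i • g i).prod = (∏ i, c i) • (List.ofFn g).prod := by
  induction m with
  | zero => simp
  | succ m ih =>
    rw [List.ofFn_succ, List.prod_cons, ih, Fin.prod_univ_succ, List.ofFn_succ, List.prod_cons,
      smul_mul_smul_comm]

theorem sum_smul_pow {R : Type*} [CommSemiring R] [Semiring A] [Algebra R A] (y : ι → R)
    (x : ι → A) (m : ℕ) :
    (∑ a, y a • x a) ^ m = ∑ p : Fin m → ι, (∏ i, y (p i)) • word x p := by
  have h := prod_ofFn_sum (fun (_ : Fin m) a => y a • x a)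
  rw [List.ofFn_const, List.prod_replicate] at h
  rw [h]
  exact Finset.sum_congr rfl fun p _ => prod_ofFn_smul _ _

/-- Each pair of letters sums to one factor $\sum_a x_a^2$. The algebra is left general because the
formula is needed for numbers, for polynomials, and for differential operators, where the factor is
the Laplacian. -/
theorem sum_pairDelta_smul_word [DecidableEq ι] [Ring A] [Algebra ℂ A] (x : ι → A) (n : ℕ) :
    ∑ p : Fin (2 * n) → ι, pairDelta n p • word x p = (∑ a, x a * x a) ^ n := by
  induction n with
  | zero =>
    simp only [Nat.mul_zero, pow_zero]
    rw [Fintype.sum_unique]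
    simp [pairDelta, word_zero]
  | succ n ih =>
    rw [pow_succ', ← ih]
    refine (sum_cons (m := 2 * n + 1) _).trans ?_
    rw [Finset.sum_mul]
    refine Finset.sum_congr rfl fun a _ => ?_
    rw [sum_cons, Finset.sum_eq_single a]
    · rw [Finset.mul_sum]
      refine Finset.sum_congr rfl fun p _ => ?_
      rw [pairDelta_cons, if_pos rfl, mul_smul_comm]
      refine congrArg _ ?_
      refine (word_cons x a _).trans ?_
      rw [word_cons, mul_assoc]
    · intro b _ hb
      refine Finset.sum_eq_zero fun p _ => ?_
      rw [pairDelta_cons, if_neg (Ne.symm hb), zero_smul]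
    · simp

end Words

/-! ### Iterated derivatives and symmetrization -/

section Symmetrization

open MvPolynomial

variable {ι : Type*}

theorem derivation_finset_prod {R B κ : Type*} [CommSemiring R] [CommSemiring B] [Algebra R B]
    [DecidableEq κ] (D : Derivation R B B) (s : Finset κ) (f : κ → B) :
    D (∏ i ∈ s, f i) = ∑ j ∈ s, D (f j) * ∏ i ∈ s.erase j, f i := by
  induction s using Finset.induction_on with
  | empty => simp
  | insert a s ha ih =>
    rw [Finset.prod_insert ha, D.leibniz, ih, Finset.sum_insert ha, Finset.erase_insert ha,
      smul_eq_mul, smul_eq_mul, Finset.mul_sum, add_comm, mul_comm (D (f a))]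
    rw [mul_comm]
    refine congrArg _ (Finset.sum_congr rfl fun j hj => ?_)
    have hja : a ≠ j := fun h => ha (h ▸ hj)
    rw [Finset.erase_insert_of_ne hja, Finset.prod_insert (by simp [ha])]
    ring

/-- The remaining indices are enumerated in the way in which `Equiv.Perm.decomposeFin` builds a
permutation from the image of `0` and a smaller permutation. -/
theorem prod_erase_eq_prod_swap {B : Type*} [CommMonoid B] {m : ℕ} (f : Fin (m + 1) → B)
    (j : Fin (m + 1)) :
    ∏ i ∈ Finset.univ.erase j, f i = ∏ i : Fin m, f (Equiv.swap 0 j i.succ) := by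
  symm
  refine Finset.prod_bij (fun i _ => Equiv.swap 0 j i.succ) ?_ ?_ ?_ ?_
  · intro i _
    simp only [Finset.mem_erase, Finset.mem_univ, and_true]
    intro h
    have := (Equiv.swap 0 j).injective (h.trans (Equiv.swap_apply_left 0 j).symm)
    exact Fin.succ_ne_zero _ this
  · intro a _ b _ h
    exact Fin.succ_injective _ ((Equiv.swap 0 j).injective h)
  · intro b hb
    have hb' : Equiv.swap 0 j b ≠ 0 := by
      intro h
      have := (Equiv.swap 0 j).injective (h.trans (Equiv.swap_apply_right 0 j).symm)
      exact (Finset.mem_erase.1 hb).1 this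
    obtain ⟨i, hi⟩ := Fin.exists_succ_eq.2 hb'
    exact ⟨i, Finset.mem_univ _, by rw [hi, Equiv.swap_apply_self]⟩
  · intro _ _; rfl

/-- Partial derivatives as endomorphisms. -/
def partialDeriv (a : ι) : Module.End ℂ (MvPolynomial ι ℂ) := (pderiv a).toLinearMap

/-- The commutator of two derivations is again a derivation, so it suffices that it kills the
variables. -/
theorem commute_partialDeriv (a b : ι) : Commute (partialDeriv a) (partialDeriv b) := by
  classical
  have h : ⁅(pderiv a : Derivation ℂ (MvPolynomial ι ℂ) (MvPolynomial ι ℂ)),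
      (pderiv b : Derivation ℂ (MvPolynomial ι ℂ) (MvPolynomial ι ℂ))⁆ = 0 := by
    refine MvPolynomial.derivation_ext (R := ℂ) ?_
    intro i
    simp [Derivation.commutator_apply, pderiv_X, Pi.single_apply, apply_ite]
  refine LinearMap.ext fun f => ?_
  have := congrArg (fun D : Derivation ℂ (MvPolynomial ι ℂ) (MvPolynomial ι ℂ) => D f) h
  simpa [Derivation.commutator_apply, sub_eq_zero, partialDeriv] using this

variable [DecidableEq ι]

/-- By the Leibniz rule each derivative in turn removes one matching factor; the positions of the
removed factors form a permutation. -/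
theorem word_partialDeriv_prod_X {m : ℕ} (q p : Fin m → ι) :
    word partialDeriv q (∏ i, X (p i)) =
      C (∑ σ : Equiv.Perm (Fin m), if p ∘ σ = q then (1 : ℂ) else 0) := by
  induction m with
  | zero => simp [word_zero, Subsingleton.elim (p ∘ _) q]
  | succ m ih =>
    -- The first letter of the word is the outermost operator; it has to act first for the
    -- induction.
    have hc : Commute (partialDeriv (q 0)) (word partialDeriv fun i => q i.succ) := by
      apply Commute.list_prod_right
      intro z hz
      obtain ⟨i, rfl⟩ := (List.mem_ofFn' _ _).1 hz
      exact commute_partialDeriv _ _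
    rw [word_succ, hc.eq, Module.End.mul_apply]
    have h1 : partialDeriv (q 0) (∏ i, X (p i)) =
        ∑ j, (if p j = q 0 then (1 : ℂ) else 0) • ∏ i : Fin m, X (p (Equiv.swap 0 j i.succ)) := by
      change pderiv (q 0) (∏ i, X (p i)) = _
      rw [derivation_finset_prod]
      refine Finset.sum_congr rfl fun j _ => ?_
      rw [prod_erase_eq_prod_swap, pderiv_X, Pi.single_apply]
      by_cases h : p j = q 0
      · simp [h]
      · simp [h]
    rw [h1, map_sum]
    rw [← (Equiv.Perm.decomposeFin (n := m)).symm.sum_comp, Fintype.sum_prod_type, map_sum]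
    refine Finset.sum_congr rfl fun j _ => ?_
    rw [map_smul, ih, smul_eq_C_mul, ← C_mul, Finset.mul_sum]
    refine congrArg C (Finset.sum_congr rfl fun σ _ => ?_)
    simp only [funext_iff, Fin.forall_fin_succ, Function.comp_apply,
      Equiv.Perm.decomposeFin_symm_apply_zero, Equiv.Perm.decomposeFin_symm_apply_succ]
    by_cases h : p j = q 0 <;> simp [h]

variable [Fintype ι]

theorem word_partialDeriv_sum {m : ℕ} (c : (Fin m → ι) → ℂ) (q : Fin m → ι) :
    word partialDeriv q (∑ p, C (c p) * ∏ i, X (p i)) =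
      C (∑ σ : Equiv.Perm (Fin m), c (q ∘ σ)) := by
  simp only [map_sum, ← smul_eq_C_mul, map_smul, word_partialDeriv_prod_X]
  simp only [smul_eq_C_mul, ← C_mul, ← map_sum]
  congr 1
  simp only [Finset.mul_sum]
  -- After inversion of `σ`, the condition on `p` has the unique solution `q ∘ σ`.
  rw [Finset.sum_comm, ← Equiv.sum_comp (Equiv.inv (Equiv.Perm (Fin m)))]
  refine Finset.sum_congr rfl fun σ _ => ?_
  rw [Finset.sum_eq_single (q ∘ σ)]
  · simp [Function.comp_def]
  · intro p _ hp
    rw [if_neg, mul_zero]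
    intro h
    apply hp
    rw [← h]
    ext i
    simp
  · simp

/-- The symmetrization of a tensor is determined by the polynomial that it defines. -/
theorem sum_perm_eq_of_eval_eq {m : ℕ} (c c' : (Fin m → ι) → ℂ)
    (h : ∀ y : ι → ℂ, ∑ p, c p * ∏ i, y (p i) = ∑ p, c' p * ∏ i, y (p i)) (q : Fin m → ι) :
    ∑ σ : Equiv.Perm (Fin m), c (q ∘ σ) = ∑ σ : Equiv.Perm (Fin m), c' (q ∘ σ) := by
  have h1 : (∑ p, C (c p) * ∏ i, X (p i) : MvPolynomial ι ℂ) =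
      ∑ p, C (c' p) * ∏ i, X (p i) := by
    apply MvPolynomial.funext
    intro y
    simpa using h y
  apply C_injective ι ℂ
  rw [← word_partialDeriv_sum, ← word_partialDeriv_sum, h1]

theorem sum_pairDelta_mul_prod (n : ℕ) (y : ι → ℂ) :
    ∑ p : Fin (2 * n) → ι, pairDelta n p * ∏ i, y (p i) = (∑ a, y a * y a) ^ n := by
  rw [← sum_pairDelta_smul_word]
  simp [word_eq_prod]

/-- If a linear functional `t` is given on the powers `(∑ yₐ xₐ) ^ 2n` by `κ (∑ yₐ²) ^ n`, then
this determines it on all symmetrized words. -/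
theorem sum_perm_map_word {A : Type*} [Ring A] [Algebra ℂ A] (x : ι → A) (t : A →ₗ[ℂ] ℂ) (n : ℕ)
    (κ : ℂ) (h : ∀ y : ι → ℂ, t ((∑ a, y a • x a) ^ (2 * n)) = κ * (∑ a, y a * y a) ^ n)
    (q : Fin (2 * n) → ι) :
    ∑ σ : Equiv.Perm (Fin (2 * n)), t (word x (q ∘ σ)) =
      κ * ∑ σ : Equiv.Perm (Fin (2 * n)), pairDelta n (q ∘ σ) := by
  rw [Finset.mul_sum]
  refine sum_perm_eq_of_eval_eq (fun p => t (word x p)) (fun p => κ * pairDelta n p)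
    (fun y => ?_) q
  have h1 := h y
  rw [sum_smul_pow, map_sum] at h1
  simp only [map_smul, smul_eq_mul] at h1
  simp only [mul_assoc, ← Finset.mul_sum, sum_pairDelta_mul_prod, ← h1]
  exact Finset.sum_congr rfl fun p _ => mul_comm _ _

/-- The complete contraction of the symmetrized `n`-th power of the metric of a
three-dimensional space. -/
theorem sum_pairDelta_sum_perm (n : ℕ) :
    ∑ q : Fin (2 * n) → Fin 3, pairDelta n q *
      ∑ σ : Equiv.Perm (Fin (2 * n)), pairDelta n (q ∘ σ) = ((2 * n + 1)! : ℂ) := by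
  -- The inner sum is the derivative of `r ^ n` along the word `q`; summing over the paired words
  -- `q` applies the `n`-th power of the Laplacian to `r ^ n`.
  set r : MvPolynomial (Fin 3) ℂ := ∑ a, X a * X a with hr
  have hF : (∑ p : Fin (2 * n) → Fin 3, C (pairDelta n p) * ∏ i, X (p i) :
      MvPolynomial (Fin 3) ℂ) = r ^ n := by
    rw [hr, ← sum_pairDelta_smul_word]
    simp [word_eq_prod, smul_eq_C_mul]
  have hd : ∀ a, pderiv a r = 2 * X a := by
    intro a
    fin_cases a <;> simp [hr, Fin.sum_univ_three, pderiv_X] <;> ring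
  have hstep : ∀ k : ℕ, (∑ a, partialDeriv a * partialDeriv a :
      Module.End ℂ (MvPolynomial (Fin 3) ℂ)) (r ^ (k + 1)) =
        ((2 * k + 2) * (2 * k + 3) : ℂ) • r ^ k := by
    intro k
    have h1 : ∀ a, pderiv a (pderiv a (r ^ (k + 1))) =
        2 * ((k : MvPolynomial (Fin 3) ℂ) + 1) * r ^ k +
          4 * ((k : MvPolynomial (Fin 3) ℂ) + 1) * (k : MvPolynomial (Fin 3) ℂ) *
            (r ^ (k - 1) * (X a * X a)) := by
      intro a
      rw [pderiv_pow, hd, Derivation.leibniz, Derivation.leibniz, Derivation.leibniz, pderiv_pow,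
        hd, pderiv_X_self, Derivation.map_natCast]
      have : pderiv a (2 : MvPolynomial (Fin 3) ℂ) = 0 := Derivation.map_natCast _ 2
      rw [this]
      simp only [smul_eq_mul, Nat.add_sub_cancel]
      push_cast
      ring
    -- The factor `k` makes the truncated exponent harmless at `k = 0`.
    have h2 : (k : MvPolynomial (Fin 3) ℂ) * (r ^ (k - 1) * r) = k * r ^ k := by
      cases k with
      | zero => simp
      | succ k => rw [Nat.add_sub_cancel, pow_succ]
    rw [LinearMap.sum_apply]
    change ∑ a, pderiv a (pderiv a (r ^ (k + 1))) = _
    simp only [h1]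
    rw [Finset.sum_add_distrib, ← Finset.mul_sum, ← Finset.mul_sum, ← Finset.mul_sum, ← hr]
    simp only [Finset.sum_const, Finset.card_univ, Fintype.card_fin, smul_eq_C_mul]
    simp only [nsmul_eq_mul, map_mul, map_add, map_natCast, map_ofNat]
    push_cast
    linear_combination (4 * (k + 1) : MvPolynomial (Fin 3) ℂ) * h2
  have hpow : ∀ k : ℕ, ((∑ a, partialDeriv a * partialDeriv a :
      Module.End ℂ (MvPolynomial (Fin 3) ℂ)) ^ k) (r ^ k) = C ((2 * k + 1)! : ℂ) := by
    intro k
    induction k with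
    | zero => simp
    | succ k ih =>
      rw [pow_succ, Module.End.mul_apply, hstep, map_smul, ih, smul_eq_C_mul, ← C_mul]
      congr 1
      rw [show 2 * (k + 1) + 1 = (2 * k + 1) + 1 + 1 by ring, Nat.factorial_succ (2 * k + 1 + 1),
        Nat.factorial_succ (2 * k + 1)]
      push_cast
      ring
  apply C_injective (Fin 3) ℂ
  rw [← hpow n, ← sum_pairDelta_smul_word, ← hF, LinearMap.sum_apply, map_sum]
  refine Finset.sum_congr rfl fun q _ => ?_
  rw [LinearMap.smul_apply, word_partialDeriv_sum, C_mul, smul_eq_C_mul]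

end Symmetrization

/-! ### An orthonormal basis of `sl_2` -/

/-- A square root of two. -/
def sqrtTwo : ℂ := ((Real.sqrt 2 : ℝ) : ℂ)

theorem sqrtTwo_mul_self : sqrtTwo * sqrtTwo = 2 := by
  rw [sqrtTwo, ← Complex.ofReal_mul, Real.mul_self_sqrt (by norm_num)]
  norm_num

/-- The scaled Pauli matrices, an orthonormal basis for the trace form. -/
def orthoBasis : Fin 3 → SlTwo :=
  ![(sqrtTwo / 2) • (slE + slF), (-Complex.I * sqrtTwo / 2) • (slE - slF), (sqrtTwo / 2) • slH]

/-- The Levi-Civita symbol. -/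
def leviCivita : Fin 3 → Fin 3 → Fin 3 → ℤ :=
  ![![![0, 0, 0], ![0, 0, 1], ![0, -1, 0]], ![![0, 0, -1], ![0, 0, 0], ![1, 0, 0]],
    ![![0, 1, 0], ![-1, 0, 0], ![0, 0, 0]]]

/-- The structure constants, in the order in which they enter at a trivalent vertex. -/
def vertexTensor (i j k : Fin 3) : ℂ := -(Complex.I * sqrtTwo) * leviCivita i j k

theorem vertexTensor_swap (i j k : Fin 3) : vertexTensor i k j = -vertexTensor i j k := by
  have h : ∀ i j k, leviCivita i k j = -leviCivita i j k := by decide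
  rw [vertexTensor, vertexTensor, h]
  push_cast
  ring

theorem vertexTensor_rotate (i j k : Fin 3) : vertexTensor j k i = vertexTensor i j k := by
  have h : ∀ i j k, leviCivita j k i = leviCivita i j k := by decide
  rw [vertexTensor, vertexTensor, h]

theorem vertexTensor_self (i j : Fin 3) : vertexTensor i j i = 0 := by
  have h : ∀ i j, leviCivita i j i = 0 := by decide
  rw [vertexTensor, h]
  simp

/-- This is the Jacobi identity. The scalar factors out, leaving a finite check on integers. -/
theorem vertexTensor_invariant (s a b c : Fin 3) :
    ∑ q, vertexTensor s a q * vertexTensor q b c + ∑ q, vertexTensor s b q * vertexTensor a q c +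
      ∑ q, vertexTensor s c q * vertexTensor a b q = 0 := by
  have h : ∀ s a b c, ∑ q, leviCivita s a q * leviCivita q b c +
      ∑ q, leviCivita s b q * leviCivita a q c + ∑ q, leviCivita s c q * leviCivita a b q = 0 := by
    decide
  have h1 : ((∑ q, leviCivita s a q * leviCivita q b c +
      ∑ q, leviCivita s b q * leviCivita a q c +
        ∑ q, leviCivita s c q * leviCivita a b q : ℤ) : ℂ) = 0 := by
    rw [h]; simp
  push_cast at h1
  simp only [vertexTensor, mul_mul_mul_comm _ _ (-(Complex.I * sqrtTwo)), ← Finset.mul_sum]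
  linear_combination (-(Complex.I * sqrtTwo) * -(Complex.I * sqrtTwo)) * h1

theorem lie_slE_slF : ⁅slE, slF⁆ = slH := by
  apply Subtype.ext
  ext a b
  fin_cases a <;> fin_cases b <;>
    simp [slE, slF, slH, Ring.lie_def]

theorem lie_slH_slE : ⁅slH, slE⁆ = (2 : ℂ) • slE := by
  apply Subtype.ext
  ext a b
  fin_cases a <;> fin_cases b <;>
    simp [slE, slH, Ring.lie_def]
  norm_num

theorem lie_slH_slF : ⁅slH, slF⁆ = (-2 : ℂ) • slF := by
  apply Subtype.ext
  ext a b
  fin_cases a <;> fin_cases b <;>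
    simp [slF, slH, Ring.lie_def]
  norm_num

/-- The order of `k` and `j` is that of STU: half-edge `2` of the new vertex takes the place of the
first of the two points on the circle. -/
theorem lie_orthoBasis (j k : Fin 3) :
    ⁅orthoBasis k, orthoBasis j⁆ = ∑ i, vertexTensor i j k • orthoBasis i := by
  have hs := sqrtTwo_mul_self
  have hI := Complex.I_mul_I
  have h1 : ⁅slF, slE⁆ = -slH := by rw [← lie_skew, lie_slE_slF]
  have h2 : ⁅slE, slH⁆ = -((2 : ℂ) • slE) := by rw [← lie_skew, lie_slH_slE]
  have h3 : ⁅slF, slH⁆ = -((-2 : ℂ) • slF) := by rw [← lie_skew, lie_slH_slF]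
  fin_cases j <;> fin_cases k <;>
    simp only [orthoBasis, vertexTensor, leviCivita, Fin.sum_univ_three, Fin.zero_eta, Fin.mk_one,
      Fin.reduceFinMk, Matrix.cons_val_zero, Matrix.cons_val_one, Matrix.cons_val, lie_self,
      lie_smul, smul_lie, lie_add, add_lie, lie_sub, sub_lie, h1, h2, h3, lie_slE_slF,
      lie_slH_slE, lie_slH_slF] <;>
    push_cast
  all_goals
    match_scalars <;>
    first
    | ring1
    | (linear_combination (sqrtTwo * sqrtTwo / 2) * hI)
    | (linear_combination (-sqrtTwo * sqrtTwo / 2) * hI)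

/-- The coefficients of `a₁, a₂, a₃` in the orthonormal basis. -/
def coeffA : Fin 3 → Fin 3 → ℂ :=
  ![![sqrtTwo / 2, Complex.I * sqrtTwo / 2, 0], ![0, 0, sqrtTwo],
    ![sqrtTwo / 2, -Complex.I * sqrtTwo / 2, 0]]

/-- The coefficients of `b₁, b₂, b₃` in the orthonormal basis. -/
def coeffB : Fin 3 → Fin 3 → ℂ :=
  ![![sqrtTwo / 2, -Complex.I * sqrtTwo / 2, 0], ![0, 0, sqrtTwo / 2],
    ![sqrtTwo / 2, Complex.I * sqrtTwo / 2, 0]]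

theorem basisA_eq_sum (i : Fin 3) : basisA i = ∑ p, coeffA i p • orthoBasis p := by
  have hs := sqrtTwo_mul_self
  have hI := Complex.I_mul_I
  apply Subtype.ext
  ext a b
  fin_cases i <;> fin_cases a <;> fin_cases b <;>
    simp [basisA, orthoBasis, coeffA, slE, slF, slH, Fin.sum_univ_three] <;>
    first
    | (linear_combination (-1 / 2 : ℂ) * hs)
    | (linear_combination (1 / 2 : ℂ) * hs)
    | (linear_combination (-1 / 4 : ℂ) * hs + (sqrtTwo * sqrtTwo / 4) * hI - (1 / 4 : ℂ) * hs)
    | (linear_combination (-1 / 4 : ℂ) * hs - (sqrtTwo * sqrtTwo / 4) * hI + (1 / 4 : ℂ) * hs)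

theorem basisB_eq_sum (i : Fin 3) : basisB i = ∑ p, coeffB i p • orthoBasis p := by
  have hs := sqrtTwo_mul_self
  have hI := Complex.I_mul_I
  apply Subtype.ext
  ext a b
  fin_cases i <;> fin_cases a <;> fin_cases b <;>
    simp [basisB, orthoBasis, coeffB, slE, slF, slH, Fin.sum_univ_three] <;>
    first
    | (linear_combination (-1 / 4 : ℂ) * hs)
    | (linear_combination (1 / 4 : ℂ) * hs)
    | (linear_combination (-1 / 4 : ℂ) * hs + (sqrtTwo * sqrtTwo / 4) * hI - (1 / 4 : ℂ) * hs)
    | (linear_combination (-1 / 4 : ℂ) * hs - (sqrtTwo * sqrtTwo / 4) * hI + (1 / 4 : ℂ) * hs)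

/-- The element $\sum_i a_i\otimes b_i$ is the same for all pairs of dual bases, so every chord may
carry the orthonormal basis at both ends. -/
theorem sum_coeffA_mul_coeffB (p q : Fin 3) :
    ∑ i, coeffA i p * coeffB i q = if p = q then 1 else 0 := by
  have hs := sqrtTwo_mul_self
  have hI := Complex.I_mul_I
  fin_cases p <;> fin_cases q <;>
    simp [coeffA, coeffB, Fin.sum_univ_three] <;>
    first
    | (linear_combination (1 / 2 : ℂ) * hs)
    | (linear_combination (1 / 2 : ℂ) * hs - (sqrtTwo * sqrtTwo / 2) * hI)
    | ring1

/-- The orthonormal basis in `U(sl_2)`. -/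
def orthoGen (i : Fin 3) : USlTwo := UniversalEnvelopingAlgebra.ι ℂ (orthoBasis i)

theorem ι_lie (x y : SlTwo) : UniversalEnvelopingAlgebra.ι ℂ ⁅x, y⁆ =
    UniversalEnvelopingAlgebra.ι ℂ x * UniversalEnvelopingAlgebra.ι ℂ y -
      UniversalEnvelopingAlgebra.ι ℂ y * UniversalEnvelopingAlgebra.ι ℂ x := by
  let _ : LieRing USlTwo := LieRing.ofAssociativeRing
  let _ : LieAlgebra ℂ USlTwo := LieAlgebra.ofAssociativeAlgebra
  exact LieHom.map_lie (UniversalEnvelopingAlgebra.ι ℂ) x y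

theorem orthoGen_mul_sub (j k : Fin 3) :
    orthoGen k * orthoGen j - orthoGen j * orthoGen k = ∑ i, vertexTensor i j k • orthoGen i := by
  have h := ι_lie (orthoBasis k) (orthoBasis j)
  rw [orthoGen, orthoGen, ← h, lie_orthoBasis, map_sum]
  simp only [orthoGen, map_smul]

/-- A commutator is a derivation and acts on one letter at a time. The right-hand side is, up to
sign, the expression that `Diagram.contract_act` annihilates. -/
theorem orthoGen_mul_word_sub (s : Fin 3) {m : ℕ} (p : Fin m → Fin 3) :
    orthoGen s * word orthoGen p - word orthoGen p * orthoGen s =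
      -∑ j, ∑ q, vertexTensor s (p j) q • word orthoGen (Function.update p j q) := by
  induction m with
  | zero => simp [word_zero]
  | succ m ih =>
    have h0 : ∀ q, word orthoGen (Function.update p 0 q) =
        orthoGen q * word orthoGen fun i => p i.succ := by
      intro q
      rw [word_succ]
      simp [Function.update_of_ne]
    have h1 : ∀ (j : Fin m) q, word orthoGen (Function.update p j.succ q) =
        orthoGen (p 0) * word orthoGen (Function.update (fun i => p i.succ) j q) := by
      intro j q
      rw [word_succ, Function.update_of_ne (Fin.succ_ne_zero j).symm]
      congr 2
      ext i
      by_cases hij : i = j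
      · simp [hij]
      · rw [Function.update_of_ne hij, Function.update_of_ne (fun h => hij (Fin.succ_injective _ h))]
    rw [Fin.sum_univ_succ]
    simp only [h1, ← mul_smul_comm, ← Finset.mul_sum]
    simp only [h0, ← smul_mul_assoc, ← Finset.sum_mul]
    have h2 : ∑ q, vertexTensor s (p 0) q • orthoGen q =
        -(orthoGen s * orthoGen (p 0) - orthoGen (p 0) * orthoGen s) := by
      rw [orthoGen_mul_sub, ← Finset.sum_neg_distrib]
      refine Finset.sum_congr rfl fun q _ => ?_
      rw [← neg_smul, ← vertexTensor_swap, vertexTensor_rotate]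
    have h3 := ih fun i => p i.succ
    rw [h2, neg_add, ← mul_neg (orthoGen (p 0)), ← h3, word_succ]
    noncomm_ring

/-! ### The weight of a diagram as a state sum -/

/-- The product of the structure constants at the trivalent vertices. -/
def vertexWeight {k m : ℕ} (l : HalfEdge k m → Fin 3) : ℂ :=
  ∏ v : Fin k, vertexTensor (l (Sum.inl (v, 0))) (l (Sum.inl (v, 1))) (l (Sum.inl (v, 2)))

variable {M : Type*} [AddCommGroup M] [Module ℂ M]

/-- The contraction of the tensor of a diagram with a function of the labels of its legs. -/
def Diagram.contract {k m : ℕ} (D : Diagram k m) (G : (Fin m → Fin 3) → M) : M :=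
  ∑ l : HalfEdge k m → Fin 3 with ∀ h, l (D.edge h) = l h,
    vertexWeight l • G fun j => l (Sum.inr j)

/-- The infinitesimal action of the `s`-th basis element at the argument `h`. -/
def actAt {H : Type*} [DecidableEq H] (s : Fin 3) (h : H) (F : (H → Fin 3) → M)
    (l : H → Fin 3) : M :=
  ∑ q, vertexTensor s (l h) q • F (Function.update l h q)

theorem forall_update_edge_iff {H : Type*} [DecidableEq H] (e : H → H) (he : ∀ h, e (e h) = h)
    (hne : ∀ h, e h ≠ h) (l : H → Fin 3) (h : H) (q : Fin 3) :
    (∀ g, Function.update l h q (e g) = Function.update l h q g) ↔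
      q = l (e h) ∧ ∀ g, g ≠ h → g ≠ e h → l (e g) = l g := by
  constructor
  · intro H
    refine ⟨?_, fun g h1 h2 => ?_⟩
    · have := H h
      rw [Function.update_self, Function.update_of_ne (hne h)] at this
      exact this.symm
    · have := H g
      rwa [Function.update_of_ne h1, Function.update_of_ne] at this
      intro h3
      exact h2 (by rw [← h3, he])
  · rintro ⟨rfl, H⟩ g
    by_cases h1 : g = h
    · subst h1
      rw [Function.update_self, Function.update_of_ne (hne g)]
    · by_cases h2 : g = e h
      · subst h2
        rw [he, Function.update_self, Function.update_of_ne (hne h)]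
      · rw [Function.update_of_ne h1, Function.update_of_ne, H g h1 h2]
        intro h3
        exact h2 (by rw [← h3, he])

/-- Invariance of the form: the actions at the two ends of an edge cancel. Exchanging the old and
the new label at `h` moves the action from `F` to the compatibility condition, which leaves a
coefficient that is antisymmetric in `h` and `e h`. -/
theorem sum_actAt_eq_zero {H : Type*} [Fintype H] [DecidableEq H] (e : H → H)
    (he : ∀ h, e (e h) = h) (hne : ∀ h, e h ≠ h) (s : Fin 3) (F : (H → Fin 3) → M) :
    ∑ l : H → Fin 3 with ∀ h, l (e h) = l h, ∑ h, actAt s h F l = 0 := by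
  classical
  have h1 : ∀ h : H, ∑ l : H → Fin 3 with ∀ h, l (e h) = l h, actAt s h F l =
      ∑ l : H → Fin 3, (if ∀ g, g ≠ h → g ≠ e h → l (e g) = l g then
        vertexTensor s (l (e h)) (l h) else 0) • F l := by
    intro h
    rw [Finset.sum_filter]
    have h2 : ∀ l : H → Fin 3, (if ∀ h, l (e h) = l h then actAt s h F l else 0) =
        ∑ q, (if ∀ h, l (e h) = l h then vertexTensor s (l h) q else 0) •
          F (Function.update l h q) := by
      intro l
      by_cases hl : ∀ h, l (e h) = l h
      · simp [hl, actAt]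
      · simp [hl]
    simp only [h2]
    rw [← Fintype.sum_prod_type']
    have h3 : Function.Involutive fun x : (H → Fin 3) × Fin 3 =>
        ((Function.update x.1 h x.2, x.1 h) : (H → Fin 3) × Fin 3) := by
      intro x
      simp
    rw [← Equiv.sum_comp h3.toPerm]
    simp only [Function.Involutive.coe_toPerm, Function.update_self, Function.update_idem,
      Function.update_eq_self]
    rw [Fintype.sum_prod_type]
    refine Finset.sum_congr rfl fun l _ => ?_
    dsimp only
    rw [← Finset.sum_smul]
    congr 1
    simp only [forall_update_edge_iff e he hne]
    rw [Finset.sum_eq_single (l (e h))]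
    · simp
    · intro q _ hq
      simp [hq]
    · simp
  rw [Finset.sum_comm]
  simp only [h1]
  rw [Finset.sum_comm]
  refine Finset.sum_eq_zero fun l _ => ?_
  rw [← Finset.sum_smul]
  have h4 : ∀ c : H → ℂ, (∀ h, c (e h) = -c h) → ∑ h, c h = 0 := by
    intro c hc
    have he' : Function.Involutive e := he
    have h5 := Equiv.sum_comp he'.toPerm c
    simp only [Function.Involutive.coe_toPerm, hc, Finset.sum_neg_distrib] at h5
    linear_combination (-1 / 2 : ℂ) * h5
  rw [h4, zero_smul]
  intro h
  have h6 : (∀ g, g ≠ e h → g ≠ e (e h) → l (e g) = l g) ↔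
      ∀ g, g ≠ h → g ≠ e h → l (e g) = l g := by
    rw [he]
    exact ⟨fun H g a b => H g b a, fun H g a b => H g b a⟩
  simp only [h6]
  split_ifs
  · rw [he, vertexTensor_swap]
  · simp

/-- The factors of the other vertices do not involve the labels at `v`; the remaining factor
vanishes by the Jacobi identity. -/
theorem sum_vertex_actAt {k m : ℕ} (s : Fin 3) (v : Fin k) (l : HalfEdge k m → Fin 3) :
    ∑ i : Fin 3, actAt s (Sum.inl (v, i)) vertexWeight l = 0 := by
  have h1 : ∀ l' : HalfEdge k m → Fin 3, (∀ v', v' ≠ v → ∀ i, l' (Sum.inl (v', i)) =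
      l (Sum.inl (v', i))) → vertexWeight l' = (∏ v' ∈ Finset.univ.erase v,
        vertexTensor (l (Sum.inl (v', 0))) (l (Sum.inl (v', 1))) (l (Sum.inl (v', 2)))) *
        vertexTensor (l' (Sum.inl (v, 0))) (l' (Sum.inl (v, 1))) (l' (Sum.inl (v, 2))) := by
    intro l' hl'
    rw [vertexWeight, ← Finset.prod_erase_mul _ _ (Finset.mem_univ v)]
    congr 1
    refine Finset.prod_congr rfl fun v' hv' => ?_
    rw [hl' v' (Finset.ne_of_mem_erase hv'), hl' v' (Finset.ne_of_mem_erase hv'),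
      hl' v' (Finset.ne_of_mem_erase hv')]
  have h2 : ∀ (i : Fin 3) (q : Fin 3),
      vertexWeight (Function.update l (Sum.inl (v, i)) q) = _ := fun i q =>
    h1 _ fun v' hv' j => Function.update_of_ne (by simp [hv']) _ _
  simp only [actAt, h2, Fin.sum_univ_three (M := ℂ) (fun i : Fin 3 => ∑ q, _)]
  have h3 := vertexTensor_invariant s (l (Sum.inl (v, 0))) (l (Sum.inl (v, 1)))
    (l (Sum.inl (v, 2)))
  simp only [smul_eq_mul, mul_left_comm (vertexTensor s _ _), ← Finset.mul_sum]
  rw [← mul_add, ← mul_add]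
  apply mul_eq_zero_of_right
  simpa [Function.update_apply] using h3

/-- The tensor of a diagram is invariant. -/
theorem Diagram.contract_act {k m : ℕ} (D : Diagram k m) (s : Fin 3)
    (G : (Fin m → Fin 3) → M) :
    D.contract (fun p => ∑ j, ∑ q, vertexTensor s (p j) q • G (Function.update p j q)) = 0 := by
  -- The action on all half-edges sums to zero by edges, and the part at the trivalent vertices is
  -- zero by vertices. What is left is the action on the legs.
  rw [← sum_actAt_eq_zero D.edge D.edge_edge D.edge_ne s
    (fun l => vertexWeight l • G fun j => l (Sum.inr j)), Diagram.contract]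
  refine Finset.sum_congr rfl fun l _ => ?_
  rw [Fintype.sum_sum_type, Fintype.sum_prod_type]
  have h1 : ∀ v : Fin k, ∑ i : Fin 3, actAt s (Sum.inl (v, i))
      (fun l : HalfEdge k m → Fin 3 => vertexWeight l • G fun j => l (Sum.inr j)) l = 0 := by
    intro v
    have h2 := sum_vertex_actAt s v l
    simp only [actAt] at h2 ⊢
    simp only [Function.update_of_ne Sum.inr_ne_inl, smul_smul, ← Finset.sum_smul]
    simp only [smul_eq_mul] at h2
    rw [h2, zero_smul]
  simp only [h1, Finset.sum_const_zero, zero_add, Finset.smul_sum]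
  refine Finset.sum_congr rfl fun j _ => ?_
  rw [actAt]
  refine Finset.sum_congr rfl fun q _ => ?_
  rw [smul_comm]
  have h3 : vertexWeight (Function.update l (Sum.inr j) q) = vertexWeight l := by
    simp [vertexWeight, Function.update_of_ne]
  have h4 : (fun i => Function.update l (Sum.inr j) q (Sum.inr i)) =
      Function.update (fun i => l (Sum.inr i)) j q := by
    ext i
    by_cases hij : i = j
    · simp [hij]
    · rw [Function.update_of_ne hij, Function.update_of_ne (by simp [hij])]
  rw [h3, h4]

theorem Diagram.map_contract {N F : Type*} [AddCommGroup N] [Module ℂ N] [FunLike F M N]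
    [LinearMapClass F ℂ M N] {k m : ℕ} (D : Diagram k m) (f : F) (G : (Fin m → Fin 3) → M) :
    f (D.contract G) = D.contract fun p => f (G p) := by
  simp [Diagram.contract, map_sum]

theorem Diagram.contract_sub {k m : ℕ} (D : Diagram k m) (G G' : (Fin m → Fin 3) → M) :
    D.contract G - D.contract G' = D.contract fun p => G p - G' p := by
  simp [Diagram.contract, smul_sub]

theorem Diagram.contract_neg {k m : ℕ} (D : Diagram k m) (G : (Fin m → Fin 3) → M) :
    D.contract (fun p => -G p) = -D.contract G := by
  simp [Diagram.contract]

theorem Diagram.sum_contract {κ : Type*} (s : Finset κ) {k m : ℕ} (D : Diagram k m)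
    (G : κ → (Fin m → Fin 3) → M) :
    ∑ a ∈ s, D.contract (G a) = D.contract fun p => ∑ a ∈ s, G a p := by
  simp only [Diagram.contract, Finset.smul_sum]
  rw [Finset.sum_comm]

/-- The weight of a diagram. -/
def Diagram.weight {k m : ℕ} (D : Diagram k m) : USlTwo := D.contract (word orthoGen)

theorem Diagram.commute_weight {k m : ℕ} (D : Diagram k m) (s : Fin 3) :
    Commute (orthoGen s) D.weight := by
  rw [commute_iff_eq, ← sub_eq_zero]
  have h1 : orthoGen s * D.weight = D.contract fun p => orthoGen s * word orthoGen p :=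
    D.map_contract (LinearMap.mulLeft ℂ (orthoGen s)) _
  have h2 : D.weight * orthoGen s = D.contract fun p => word orthoGen p * orthoGen s :=
    D.map_contract (LinearMap.mulRight ℂ (orthoGen s)) _
  rw [h1, h2, Diagram.contract_sub]
  simp only [orthoGen_mul_word_sub]
  rw [Diagram.contract_neg, D.contract_act, neg_zero]

/-! ### Isomorphisms and independence of the base point -/

/-- A renumbering of the vertices, a rotation at each of them, and a renumbering of the legs. -/
def halfEdgeEquiv {k m : ℕ} (π : Equiv.Perm (Fin k)) (r : Fin k → Fin 3)
    (ρ : Equiv.Perm (Fin m)) : Equiv.Perm (HalfEdge k m) :=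
  Equiv.sumCongr
    { toFun := fun p => (π p.1, p.2 + r p.1)
      invFun := fun p => (π.symm p.1, p.2 - r (π.symm p.1))
      left_inv := fun p => by simp
      right_inv := fun p => by simp } ρ

theorem vertexWeight_comp_halfEdgeEquiv {k m : ℕ} (π : Equiv.Perm (Fin k)) (r : Fin k → Fin 3)
    (ρ : Equiv.Perm (Fin m)) (l : HalfEdge k m → Fin 3) :
    vertexWeight (fun h => l (halfEdgeEquiv π r ρ h)) = vertexWeight l := by
  rw [vertexWeight, vertexWeight, ← Equiv.prod_comp π (fun v => vertexTensor (l (Sum.inl (v, 0))) _ _)]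
  refine Finset.prod_congr rfl fun v _ => ?_
  simp only [halfEdgeEquiv, Equiv.sumCongr_apply, Sum.map_inl, Equiv.coe_fn_mk]
  generalize r v = a
  fin_cases a
  · simp
  · exact vertexTensor_rotate _ _ _
  · exact (vertexTensor_rotate _ _ _).trans (vertexTensor_rotate _ _ _)

theorem Diagram.contract_of_edge {k m : ℕ} (D D' : Diagram k m) (π : Equiv.Perm (Fin k))
    (r : Fin k → Fin 3) (ρ : Equiv.Perm (Fin m))
    (h : ∀ x, D'.edge (halfEdgeEquiv π r ρ x) = halfEdgeEquiv π r ρ (D.edge x))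
    (G : (Fin m → Fin 3) → M) :
    D'.contract G = D.contract fun p => G fun j => p (ρ.symm j) := by
  rw [Diagram.contract, Diagram.contract]
  refine Finset.sum_bij' (fun l _ x => l (halfEdgeEquiv π r ρ x))
    (fun l _ x => l ((halfEdgeEquiv π r ρ).symm x)) ?_ ?_ ?_ ?_ ?_
  · intro l hl
    simp only [Finset.mem_filter, Finset.mem_univ, true_and] at hl ⊢
    intro x
    rw [← h, hl]
  · intro l hl
    simp only [Finset.mem_filter, Finset.mem_univ, true_and] at hl ⊢
    intro x
    obtain ⟨x, rfl⟩ := (halfEdgeEquiv π r ρ).surjective x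
    rw [h, Equiv.symm_apply_apply, Equiv.symm_apply_apply, hl]
  · intro l _; simp
  · intro l _; simp
  · intro l _
    rw [vertexWeight_comp_halfEdgeEquiv]
    simp [halfEdgeEquiv]

theorem Diagram.contract_permuteLegs {k m : ℕ} (D : Diagram k m) (ρ : Equiv.Perm (Fin m))
    (G : (Fin m → Fin 3) → M) :
    (D.permuteLegs ρ).contract G = D.contract fun p => G fun j => p (ρ.symm j) := by
  refine D.contract_of_edge _ 1 0 ρ ?_ G
  rintro (⟨v, i⟩ | j)
  all_goals
    simp only [Diagram.permuteLegs, halfEdgeEquiv, Equiv.sumCongr_apply, Sum.map_inl, Sum.map_inr,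
      Equiv.coe_fn_mk, Equiv.symm_apply_apply, Equiv.Perm.one_apply, Pi.zero_apply, add_zero, id]
    rcases D.edge _ with ⟨v, i⟩ | j <;> simp

/-- Moving the last letter to the front changes the word by the commutator of that letter with the
rest. This is the action of a basis element on all legs but the last; on the last leg that element
would act on itself and give zero. So invariance applies. -/
theorem Diagram.contract_rotate {k m : ℕ} (D : Diagram k m) :
    (D.contract fun p => word orthoGen fun j => p ((finRotate m).symm j)) = D.weight := by
  rcases m with _ | m
  · simp only [Diagram.weight, Subsingleton.elim (finRotate 0) 1]
    rfl
  have h1 : ∀ p : Fin (m + 1) → Fin 3, (word orthoGen fun j => p ((finRotate (m + 1)).symm j)) =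
      orthoGen (p (Fin.last m)) * word orthoGen fun j => p j.castSucc := by
    intro p
    rw [word_succ]
    have h2 : (finRotate (m + 1)).symm 0 = Fin.last m := by
      rw [Equiv.symm_apply_eq, finRotate_last]
    have h3 : ∀ i : Fin m, (finRotate (m + 1)).symm i.succ = i.castSucc := by
      intro i
      rw [Equiv.symm_apply_eq, finRotate_apply, Fin.coeSucc_eq_succ]
    simp only [h2, h3]
  rw [← sub_eq_zero, Diagram.weight, Diagram.contract_sub]
  -- The acting element must equal the last letter: impose this by an indicator and sum over `s`.
  have h4 := fun s : Fin 3 => D.contract_act s fun p : Fin (m + 1) → Fin 3 =>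
    if p (Fin.last m) = s then word orthoGen fun j => p j.castSucc else 0
  have h5 := D.sum_contract Finset.univ (fun (s : Fin 3) (p : Fin (m + 1) → Fin 3) =>
    ∑ j, ∑ q, vertexTensor s (p j) q • (fun p : Fin (m + 1) → Fin 3 =>
      if p (Fin.last m) = s then word orthoGen fun j => p j.castSucc else 0)
        (Function.update p j q))
  simp only [h4, Finset.sum_const_zero] at h5
  rw [← neg_eq_zero, h5, ← Diagram.contract_neg]
  congr 1
  ext p
  rw [h1, word_castSucc, orthoGen_mul_word_sub, neg_neg, Finset.sum_comm (s := Finset.univ (α := Fin 3)),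
    Fin.sum_univ_castSucc (n := m)]
  have h6 : ∑ s, ∑ q, vertexTensor s (p (Fin.last m)) q •
      (if Function.update p (Fin.last m) q (Fin.last m) = s then
        word orthoGen fun j => Function.update p (Fin.last m) q j.castSucc else 0) = 0 := by
    refine Finset.sum_eq_zero fun s _ => Finset.sum_eq_zero fun q _ => ?_
    rw [Function.update_self]
    split_ifs with h
    · rw [h, vertexTensor_self, zero_smul]
    · rw [smul_zero]
  rw [h6, add_zero]
  refine Finset.sum_congr rfl fun j _ => ?_
  rw [Finset.sum_comm]
  refine Finset.sum_congr rfl fun q _ => ?_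
  have h7 : (fun i : Fin m => Function.update p j.castSucc q i.castSucc) =
      Function.update (fun i => p i.castSucc) j q := by
    ext i
    by_cases hij : i = j
    · simp [hij]
    · rw [Function.update_of_ne hij, Function.update_of_ne (by simp [hij])]
  rw [h7]
  simp [Function.update_of_ne (Fin.castSucc_lt_last j).ne']

theorem Diagram.contract_rotate_pow {k m : ℕ} (D : Diagram k m) (s : ℕ) :
    (D.contract fun p => word orthoGen fun j =>
      p ((finRotate m ^ s : Equiv.Perm (Fin m)).symm j)) = D.weight := by
  induction s with
  | zero => rfl
  | succ s ih =>
    have h := (D.permuteLegs (finRotate m ^ s)).contract_rotate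
    rw [Diagram.weight, D.contract_permuteLegs, D.contract_permuteLegs, ih] at h
    rw [← h, pow_succ']
    rfl

theorem Diagram.Iso.weight_eq {k m : ℕ} {D D' : Diagram k m} (h : D.Iso D') :
    D'.weight = D.weight := by
  obtain ⟨π, r, s, h⟩ := h
  rw [Diagram.weight, D.contract_of_edge D' π r (finRotate m ^ s) h, D.contract_rotate_pow]

/-! ### Agreement with the weight of chord diagrams -/

theorem ChordDiagram.contract_toDiagram {M : Type*} [AddCommGroup M] [Module ℂ M] {m : ℕ}
    (D : ChordDiagram m) (G : (Fin m → Fin 3) → M) :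
    D.toDiagram.contract G = ∑ p : Fin m → Fin 3 with ∀ i, p (D.mate i) = p i, G p := by
  rw [Diagram.contract]
  refine Finset.sum_bij' (fun l _ j => l (Sum.inr j))
    (fun p _ => Sum.elim (fun v => v.1.elim0) p) ?_ ?_ ?_ ?_ ?_
  · intro l hl
    simp only [Finset.mem_filter, Finset.mem_univ, true_and] at hl ⊢
    exact fun i => hl (Sum.inr i)
  · intro p hp
    simp only [Finset.mem_filter, Finset.mem_univ, true_and] at hp ⊢
    rintro (⟨v, _⟩ | i)
    · exact v.elim0
    · exact hp i
  · intro l _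
    ext (⟨v, _⟩ | i)
    · exact v.elim0
    · rfl
  · intro p _; rfl
  · intro l _
    simp [vertexWeight]

/-- A compatible labelling is a free choice of one label per chord, and each chord is represented by
its first endpoint. The sum therefore factors over the chords, with one Kronecker delta for each. -/
theorem ChordDiagram.sum_prod_coeff {m : ℕ} (D : ChordDiagram m) (p : Fin m → Fin 3) :
    ∑ l : Fin m → Fin 3 with ∀ i, l (D.mate i) = l i,
      ∏ i, (if i < D.mate i then coeffA (l i) (p i) else coeffB (l i) (p i)) =
        if ∀ i, p (D.mate i) = p i then 1 else 0 := by
  have hrep : ∀ i, ¬ i < D.mate i → D.mate i < D.mate (D.mate i) := fun i hi => by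
    rw [D.mate_mate]
    exact lt_of_le_of_ne (not_lt.1 hi) (D.mate_ne i)
  have hprod : ∀ f : Fin m → ℂ, ∏ i, f i =
      ∏ i : {i // i < D.mate i}, (f i.1 * f (D.mate i.1)) := by
    intro f
    rw [Finset.prod_mul_distrib, ← Finset.prod_filter_mul_prod_filter_not Finset.univ
      (fun i => i < D.mate i)]
    congr 1
    · exact Finset.prod_subtype _ (by simp) _
    · symm
      refine Finset.prod_bij (fun i _ => D.mate i.1) ?_ ?_ ?_ ?_
      · intro i _
        simp only [Finset.mem_filter, Finset.mem_univ, true_and, D.mate_mate]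
        exact not_lt.2 i.2.le
      · intro i _ j _ h
        apply Subtype.ext
        rw [← D.mate_mate i.1, h, D.mate_mate]
      · intro i hi
        simp only [Finset.mem_filter, Finset.mem_univ, true_and] at hi
        exact ⟨⟨D.mate i, hrep i hi⟩, Finset.mem_univ _, D.mate_mate i⟩
      · intro _ _; rfl
  have hA : ∀ l : Fin m → Fin 3, (∀ i, l (D.mate i) = l i) →
      ∏ i, (if i < D.mate i then coeffA (l i) (p i) else coeffB (l i) (p i)) =
        ∏ i : {i // i < D.mate i}, coeffA (l i.1) (p i.1) * coeffB (l i.1) (p (D.mate i.1)) := by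
    intro l hl
    rw [hprod]
    refine Finset.prod_congr rfl fun i _ => ?_
    rw [if_pos i.2, D.mate_mate, if_neg (not_lt.2 i.2.le), hl]
  have hB : ∑ l : Fin m → Fin 3 with ∀ i, l (D.mate i) = l i,
      ∏ i, (if i < D.mate i then coeffA (l i) (p i) else coeffB (l i) (p i)) =
      ∑ c : {i // i < D.mate i} → Fin 3,
        ∏ i : {i // i < D.mate i}, coeffA (c i) (p i.1) * coeffB (c i) (p (D.mate i.1)) := by
    refine Finset.sum_bij' (fun l _ i => l i.1)
      (fun c _ i => if h : i < D.mate i then c ⟨i, h⟩ else c ⟨D.mate i, hrep i h⟩) ?_ ?_ ?_ ?_ ?_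
    · intro l _; exact Finset.mem_univ _
    · intro c _
      simp only [Finset.mem_filter, Finset.mem_univ, true_and]
      intro i
      by_cases h : i < D.mate i
      · have h' : ¬ D.mate i < D.mate (D.mate i) := by
          rw [D.mate_mate]; exact not_lt.2 h.le
        rw [dif_pos h, dif_neg h']
        simp only [D.mate_mate]
      · rw [dif_neg h, dif_pos (hrep i h)]
    · intro l hl
      simp only [Finset.mem_filter, Finset.mem_univ, true_and] at hl
      ext i
      dsimp only
      split_ifs
      · rfl
      · rw [hl]
    · intro c _
      ext i
      dsimp only
      rw [dif_pos i.2]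
    · intro l hl
      simp only [Finset.mem_filter, Finset.mem_univ, true_and] at hl
      exact hA l hl
  rw [hB]
  have hC := Finset.prod_univ_sum (fun _ : {i // i < D.mate i} => (Finset.univ : Finset (Fin 3)))
    (fun i a => coeffA a (p i.1) * coeffB a (p (D.mate i.1)))
  rw [Fintype.piFinset_univ] at hC
  rw [← hC]
  simp only [sum_coeffA_mul_coeffB]
  rw [Finset.prod_ite_zero]
  simp only [Finset.prod_const_one, Finset.mem_univ, true_imp_iff]
  refine if_congr ⟨fun h i => ?_, fun h i => (h i.1).symm⟩ rfl rfl
  by_cases hi : i < D.mate i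
  · exact (h ⟨i, hi⟩).symm
  · have := h ⟨D.mate i, hrep i hi⟩
    simpa only [D.mate_mate] using this

theorem ChordDiagram.chordWeight_eq {m : ℕ} (D : ChordDiagram m) :
    chordWeight D = ∑ p : Fin m → Fin 3 with ∀ i, p (D.mate i) = p i, word orthoGen p := by
  have h1 : ∀ l : Fin m → Fin 3, (List.ofFn fun i : Fin m =>
      UniversalEnvelopingAlgebra.ι ℂ
        (if i < D.mate i then basisA (l i) else basisB (l i))).prod =
      ∑ p : Fin m → Fin 3, (∏ i, (if i < D.mate i then coeffA (l i) (p i)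
        else coeffB (l i) (p i))) • word orthoGen p := by
    intro l
    have h2 : ∀ i, UniversalEnvelopingAlgebra.ι ℂ
        (if i < D.mate i then basisA (l i) else basisB (l i)) =
        ∑ a, (if i < D.mate i then coeffA (l i) a else coeffB (l i) a) • orthoGen a := by
      intro i
      split_ifs
      · rw [basisA_eq_sum, map_sum]
        simp only [orthoGen, map_smul]
      · rw [basisB_eq_sum, map_sum]
        simp only [orthoGen, map_smul]
    simp only [h2]
    rw [prod_ofFn_sum]
    exact Finset.sum_congr rfl fun p _ => prod_ofFn_smul _ _
  rw [chordWeight]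
  simp only [h1]
  rw [Finset.sum_comm, Finset.sum_filter]
  refine Finset.sum_congr rfl fun p _ => ?_
  rw [← Finset.sum_smul, D.sum_prod_coeff]
  split_ifs <;> simp

theorem ChordDiagram.weight_toDiagram {m : ℕ} (D : ChordDiagram m) :
    D.toDiagram.weight = chordWeight D := by
  rw [Diagram.weight, D.contract_toDiagram, D.chordWeight_eq]

/-! ### The STU relation -/

theorem stuHalfEdge_inl {k m : ℕ} (v : Fin k) (i : Fin 3) :
    stuHalfEdge (Sum.inl (v, i) : HalfEdge k (m + 2)) = Sum.inl (v.castSucc, i) := rfl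

/-- Extension of a function along `stuHalfEdge`, by `c` on the new edge. -/
def stuExtend {α : Type*} {k m : ℕ} (c : α) (l : HalfEdge k (m + 2) → α) :
    HalfEdge (k + 1) (m + 1) → α
  | Sum.inl (v, i) =>
    Fin.lastCases (motive := fun _ => α) (![c, l (Sum.inr 1), l (Sum.inr 0)] i)
      (fun v' => l (Sum.inl (v', i))) v
  | Sum.inr j => Fin.cases c (fun j' => l (Sum.inr j'.succ.succ)) j

theorem stuExtend_stuHalfEdge {α : Type*} {k m : ℕ} (c : α) (l : HalfEdge k (m + 2) → α)
    (h : HalfEdge k (m + 2)) : stuExtend c l (stuHalfEdge h) = l h := by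
  rcases h with ⟨v, i⟩ | j
  · simp [stuHalfEdge, stuExtend]
  · refine Fin.cases ?_ (fun j => Fin.cases ?_ (fun j => ?_) j) j
    · simp [stuHalfEdge, stuExtend]
    · change stuExtend c l (Sum.inl (Fin.last k, 1)) = l (Sum.inr 1)
      simp [stuExtend]
    · simp [stuHalfEdge, stuExtend]

theorem stuExtend_last_zero {α : Type*} {k m : ℕ} (c : α) (l : HalfEdge k (m + 2) → α) :
    stuExtend c l (Sum.inl (Fin.last k, 0)) = c := by
  simp [stuExtend]

theorem stuExtend_zero {α : Type*} {k m : ℕ} (c : α) (l : HalfEdge k (m + 2) → α) :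
    stuExtend c l (Sum.inr 0) = c := rfl

theorem stuHalfEdge_injective {k m : ℕ} :
    Function.Injective (stuHalfEdge : HalfEdge k (m + 2) → HalfEdge (k + 1) (m + 1)) := by
  intro h h' hh
  -- Extending the identity gives a left inverse of `stuHalfEdge`.
  have h1 := stuExtend_stuHalfEdge h id h
  rw [hh, stuExtend_stuHalfEdge] at h1
  exact h1.symm

theorem eq_or_eq_or_exists_stuHalfEdge {k m : ℕ} (g : HalfEdge (k + 1) (m + 1)) :
    g = Sum.inl (Fin.last k, 0) ∨ g = Sum.inr 0 ∨ ∃ h, stuHalfEdge h = g := by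
  rcases g with ⟨v, i⟩ | j
  · refine Fin.lastCases ?_ (fun v => ?_) v
    · fin_cases i
      · exact Or.inl rfl
      · exact Or.inr (Or.inr ⟨Sum.inr 1, rfl⟩)
      · exact Or.inr (Or.inr ⟨Sum.inr 0, rfl⟩)
    · exact Or.inr (Or.inr ⟨Sum.inl (v, i), rfl⟩)
  · refine Fin.cases ?_ (fun j => ?_) j
    · exact Or.inr (Or.inl rfl)
    · exact Or.inr (Or.inr ⟨Sum.inr j.succ.succ, rfl⟩)

theorem stuHalfEdge_ne_last {k m : ℕ} (h : HalfEdge k (m + 2)) :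
    stuHalfEdge h ≠ Sum.inl (Fin.last k, 0) := by
  intro hh
  have h1 := stuExtend_stuHalfEdge true (fun _ => false) h
  rw [hh, stuExtend_last_zero] at h1
  exact absurd h1 (by decide)

theorem stuHalfEdge_ne_zero {k m : ℕ} (h : HalfEdge k (m + 2)) :
    stuHalfEdge h ≠ Sum.inr 0 := by
  intro hh
  have h1 := stuExtend_stuHalfEdge true (fun _ => false) h
  rw [hh, stuExtend_zero] at h1
  exact absurd h1 (by decide)

theorem stuExtend_surj {α : Type*} {k m : ℕ} (l : HalfEdge (k + 1) (m + 1) → α)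
    (h : l (Sum.inr 0) = l (Sum.inl (Fin.last k, 0))) :
    stuExtend (l (Sum.inr 0)) (fun x => l (stuHalfEdge x)) = l := by
  ext g
  rcases eq_or_eq_or_exists_stuHalfEdge g with rfl | rfl | ⟨g, rfl⟩
  · rw [stuExtend_last_zero, h]
  · rw [stuExtend_zero]
  · rw [stuExtend_stuHalfEdge]

theorem vertexWeight_stuExtend {k m : ℕ} (c : Fin 3) (l : HalfEdge k (m + 2) → Fin 3) :
    vertexWeight (stuExtend c l) =
      vertexWeight l * vertexTensor c (l (Sum.inr 1)) (l (Sum.inr 0)) := by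
  rw [vertexWeight, Fin.prod_univ_castSucc, vertexWeight]
  congr 1
  · refine Finset.prod_congr rfl fun v _ => ?_
    simp [stuExtend]
  · simp [stuExtend]

/-- A compatible labelling of `S` is one of `T` together with a label `c` of the new edge, which is
also the label of the first point on the circle. -/
theorem IsMerge.contract_eq {M : Type*} [AddCommGroup M] [Module ℂ M] {k m : ℕ}
    {T : Diagram k (m + 2)} {S : Diagram (k + 1) (m + 1)} (h : IsMerge T S)
    (G : (Fin (m + 1) → Fin 3) → M) :
    S.contract G = T.contract fun p => ∑ c, vertexTensor c (p 1) (p 0) •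
      G (Fin.cons c fun i => p i.succ.succ) := by
  have h0 : S.edge (Sum.inr 0) = Sum.inl (Fin.last k, 0) := by rw [← h.2, S.edge_edge]
  rw [Diagram.contract, Diagram.contract]
  simp only [Finset.smul_sum]
  rw [← Finset.sum_product']
  refine Finset.sum_bij' (fun l _ => (fun x => l (stuHalfEdge x), l (Sum.inr 0)))
    (fun x _ => stuExtend x.2 x.1) ?_ ?_ ?_ ?_ ?_
  · intro l hl
    simp only [Finset.mem_filter, Finset.mem_univ, true_and, Finset.mem_product, and_true] at hl ⊢
    intro x
    rw [← h.1, hl]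
  · rintro ⟨l, c⟩ hl
    simp only [Finset.mem_filter, Finset.mem_univ, true_and, Finset.mem_product, and_true] at hl ⊢
    intro g
    rcases eq_or_eq_or_exists_stuHalfEdge g with rfl | rfl | ⟨g, rfl⟩
    · rw [h.2, stuExtend_last_zero, stuExtend_zero]
    · rw [h0, stuExtend_last_zero, stuExtend_zero]
    · rw [h.1, stuExtend_stuHalfEdge, stuExtend_stuHalfEdge, hl]
  · intro l hl
    simp only [Finset.mem_filter, Finset.mem_univ, true_and] at hl
    exact stuExtend_surj l (by rw [← h.2, hl])
  · rintro ⟨l, c⟩ _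
    refine Prod.ext ?_ rfl
    ext x
    simp only [stuExtend_stuHalfEdge]
  · intro l hl
    simp only [Finset.mem_filter, Finset.mem_univ, true_and] at hl
    dsimp only
    conv_lhs => rw [← stuExtend_surj l (by rw [← h.2, hl])]
    rw [vertexWeight_stuExtend, smul_smul]
    congr 2

/-- `T` and `U` differ by the order of the first two letters, and the commutator of these is the sum
over the label of the new edge in `S`. -/
theorem IsMerge.weight_eq {k m : ℕ} {T : Diagram k (m + 2)} {S : Diagram (k + 1) (m + 1)}
    (h : IsMerge T S) :
    S.weight = T.weight - (T.permuteLegs (Equiv.swap 0 1)).weight := by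
  rw [Diagram.weight, h.contract_eq, Diagram.weight, Diagram.weight, T.contract_permuteLegs,
    T.contract_sub]
  congr 1
  ext p
  have h1 : ∀ i : Fin m, Equiv.swap (0 : Fin (m + 2)) 1 i.succ.succ = i.succ.succ := fun i =>
    Equiv.swap_apply_of_ne_of_ne (Fin.succ_ne_zero _)
      (fun hi => Fin.succ_ne_zero i (Fin.succ_injective _ hi))
  have h2 : ∀ q : Fin (m + 2) → Fin 3, word orthoGen q =
      orthoGen (q 0) * orthoGen (q 1) * word orthoGen fun i => q i.succ.succ := by
    intro q
    rw [word_succ, word_succ, mul_assoc]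
    rfl
  rw [h2, h2]
  simp only [Equiv.symm_swap, Equiv.swap_apply_left, Equiv.swap_apply_right, h1]
  rw [← sub_mul, orthoGen_mul_sub, Finset.sum_mul]
  simp only [word_cons, smul_mul_assoc]

/-! ### The weight system on trivalent diagrams -/

/-- The linear extension of the weight of diagrams. -/
def freeWeight : FreeTrivalent →ₗ[ℂ] USlTwo :=
  Finsupp.linearCombination ℂ fun D => D.2.2.weight

theorem freeWeight_freeMk {k m : ℕ} (D : Diagram k m) : freeWeight (freeMk D) = D.weight := by
  simp [freeWeight, freeMk]

theorem trivalentRelations_le_ker : trivalentRelations ≤ LinearMap.ker freeWeight := by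
  rw [trivalentRelations, Submodule.span_le]
  rintro x (⟨k, m, D, D', h, rfl⟩ | ⟨k, m, T, S, h, rfl⟩)
  · simp [freeWeight_freeMk, h.weight_eq]
  · simp [freeWeight_freeMk, h.weight_eq]

/-- The weight system on trivalent diagrams modulo STU. -/
def trivalentWeight : Trivalent →ₗ[ℂ] USlTwo :=
  trivalentRelations.liftQ freeWeight trivalentRelations_le_ker

theorem trivalentWeight_toTrivalent {k m : ℕ} (D : Diagram k m) :
    trivalentWeight D.toTrivalent = D.weight := by
  rw [Diagram.toTrivalent, trivalentWeight, Submodule.mkQ_apply, Submodule.liftQ_apply,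
    freeWeight_freeMk]

/-- This gives the independence of the chosen expression by chord diagrams: the right-hand side
depends only on the class of `a`. -/
theorem trivalentWeight_chordCombinationClass (a : FreeChord) :
    trivalentWeight (chordCombinationClass a) = chordCombinationWeight a := by
  have h : trivalentWeight ∘ₗ chordCombinationClass = chordCombinationWeight := by
    apply Finsupp.lhom_ext
    intro D c
    simp [chordCombinationClass, chordCombinationWeight, trivalentWeight_toTrivalent,
      ChordDiagram.weight_toDiagram]
  exact LinearMap.congr_fun h a

/-! ### Chord diagrams span -/

theorem Diagram.toTrivalent_eq_of_iso {k m : ℕ} {D D' : Diagram k m} (h : D.Iso D') :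
    D.toTrivalent = D'.toTrivalent := by
  rw [Diagram.toTrivalent, Diagram.toTrivalent, ← sub_eq_zero, ← map_sub, Submodule.mkQ_apply,
    Submodule.Quotient.mk_eq_zero]
  exact Submodule.subset_span (Or.inl ⟨k, m, D, D', h, rfl⟩)

theorem IsMerge.toTrivalent_eq {k m : ℕ} {T : Diagram k (m + 2)} {S : Diagram (k + 1) (m + 1)}
    (h : IsMerge T S) :
    S.toTrivalent = T.toTrivalent - (T.permuteLegs (Equiv.swap 0 1)).toTrivalent := by
  simp only [Diagram.toTrivalent]
  rw [← map_sub, ← sub_eq_zero, ← map_sub, Submodule.mkQ_apply, Submodule.Quotient.mk_eq_zero]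
  exact Submodule.subset_span (Or.inr ⟨k, m, T, S, h, rfl⟩)

/-- Transport of a diagram along a renumbering. -/
def Diagram.transport {k m : ℕ} (D : Diagram k m) (π : Equiv.Perm (Fin k)) (r : Fin k → Fin 3)
    (ρ : Equiv.Perm (Fin m)) : Diagram k m where
  edge h := halfEdgeEquiv π r ρ (D.edge ((halfEdgeEquiv π r ρ).symm h))
  edge_edge h := by simp [D.edge_edge]
  edge_ne h hh := by
    apply D.edge_ne ((halfEdgeEquiv π r ρ).symm h)
    rw [Equiv.eq_symm_apply]
    exact hh
  reach v := by
    have hψ : ∀ u i, halfEdgeEquiv π r ρ (Sum.inl (u, i)) = Sum.inl (π u, i + r u) :=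
      fun _ _ => rfl
    obtain ⟨w, hw, i, j, hij⟩ := D.reach (π.symm v)
    refine ⟨π w, ?_, i + r w, ρ j, ?_⟩
    · have h1 := Relation.ReflTransGen.lift π (p := fun u u' : Fin k => ∃ i j,
        halfEdgeEquiv π r ρ (D.edge ((halfEdgeEquiv π r ρ).symm (Sum.inl (u, i)))) =
          Sum.inl (u', j)) ?_ _ _ hw
      · simpa [Function.onFun] using h1
      · rintro u u' ⟨a, b, hab⟩
        exact ⟨a + r u, b + r u', by rw [← hψ, Equiv.symm_apply_apply, hab, hψ]⟩
    · rw [← hψ, Equiv.symm_apply_apply, hij]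
      rfl

theorem Diagram.iso_transport {k m : ℕ} (D : Diagram k m) (π : Equiv.Perm (Fin k))
    (r : Fin k → Fin 3) (s : ℕ) : D.Iso (D.transport π r (finRotate m ^ s)) := by
  refine ⟨π, r, s, fun h => ?_⟩
  change halfEdgeEquiv π r (finRotate m ^ s) (D.edge ((halfEdgeEquiv π r (finRotate m ^ s)).symm
    (halfEdgeEquiv π r (finRotate m ^ s) h))) = _
  rw [Equiv.symm_apply_apply]
  rfl

theorem exists_finRotate_pow_eq_zero {m : ℕ} (j : Fin (m + 1)) :
    ∃ s : ℕ, (finRotate (m + 1) ^ s : Equiv.Perm (Fin (m + 1))) j = 0 := by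
  suffices h : ∀ d : ℕ, ∀ j : Fin (m + 1), j.val + d = m →
      (finRotate (m + 1) ^ (d + 1) : Equiv.Perm (Fin (m + 1))) j = 0 from
    ⟨_, h (m - j.val) j (by omega)⟩
  intro d
  induction d with
  | zero =>
    intro j hj
    rw [show j = Fin.last m from Fin.ext hj, zero_add, pow_one, finRotate_last]
  | succ d ih =>
    intro j hj
    rw [pow_succ, Equiv.Perm.mul_apply]
    apply ih
    rw [coe_finRotate_of_ne_last]
    · omega
    · intro h
      rw [h, Fin.val_last] at hj
      omega

/-- Connectedness provides a vertex joined to the circle. Renumbering, rotating at the vertex and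
changing the base point bring it to the position required by `IsMerge`. -/
theorem Diagram.exists_iso_edge_last {k m : ℕ} (D : Diagram (k + 1) (m + 1)) :
    ∃ D' : Diagram (k + 1) (m + 1), D.Iso D' ∧ D'.edge (Sum.inl (Fin.last k, 0)) = Sum.inr 0 := by
  obtain ⟨w, -, i, j, hij⟩ := D.reach 0
  obtain ⟨s, hs⟩ := exists_finRotate_pow_eq_zero j
  refine ⟨_, D.iso_transport (Equiv.swap w (Fin.last k)) (fun _ => -i) s, ?_⟩
  have h1 : halfEdgeEquiv (Equiv.swap w (Fin.last k)) (fun _ => -i)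
      (finRotate (m + 1) ^ s) (Sum.inl (w, i)) = Sum.inl (Fin.last k, 0) := by
    simp [halfEdgeEquiv]
  change halfEdgeEquiv _ _ _ (D.edge ((halfEdgeEquiv _ _ _).symm _)) = _
  rw [← h1, Equiv.symm_apply_apply, hij]
  change Sum.inr ((finRotate (m + 1) ^ s : Equiv.Perm (Fin (m + 1))) j) = _
  rw [hs]

theorem Diagram.exists_isMerge {k m : ℕ} (S : Diagram (k + 1) (m + 1))
    (h : S.edge (Sum.inl (Fin.last k, 0)) = Sum.inr 0) : ∃ T, IsMerge T S := by
  have h0 : S.edge (Sum.inr 0) = Sum.inl (Fin.last k, 0) := by rw [← h, S.edge_edge]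
  have hex : ∀ x : HalfEdge k (m + 2), ∃ x', S.edge (stuHalfEdge x) = stuHalfEdge x' := by
    intro x
    rcases eq_or_eq_or_exists_stuHalfEdge (S.edge (stuHalfEdge x)) with h1 | h1 | ⟨x', h1⟩
    · have h2 := congrArg S.edge h1
      rw [S.edge_edge, h] at h2
      exact absurd h2 (stuHalfEdge_ne_zero x)
    · have h2 := congrArg S.edge h1
      rw [S.edge_edge, h0] at h2
      exact absurd h2 (stuHalfEdge_ne_last x)
    · exact ⟨x', h1.symm⟩
  choose e he using hex
  refine ⟨⟨e, fun x => ?_, fun x hx => ?_, fun v => ?_⟩, he, h⟩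
  · apply stuHalfEdge_injective
    rw [← he, ← he, S.edge_edge]
  · apply S.edge_ne (stuHalfEdge x)
    rw [he, hx]
  · obtain ⟨w, hw, i, j, hij⟩ := S.reach v.castSucc
    -- Follow a path of `S` towards the circle. If it enters the removed vertex, the half-edge
    -- leading there now ends on the circle of `T`, and the path may stop.
    have key : ∀ u, Relation.ReflTransGen
        (fun u u' => ∃ i j, S.edge (Sum.inl (u, i)) = Sum.inl (u', j)) u w →
        ∀ v : Fin k, u = v.castSucc → ∃ w : Fin k, Relation.ReflTransGen
          (fun u u' : Fin k => ∃ i j, e (Sum.inl (u, i)) = Sum.inl (u', j)) v w ∧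
          ∃ i j, e (Sum.inl (w, i)) = Sum.inr j := by
      intro u hu
      induction hu using Relation.ReflTransGen.head_induction_on with
      | refl =>
        rintro v rfl
        have h1 := he (Sum.inl (v, i))
        rw [stuHalfEdge_inl, hij] at h1
        rcases h2 : e (Sum.inl (v, i)) with ⟨v', i'⟩ | j'
        · rw [h2, stuHalfEdge_inl] at h1
          exact absurd h1 Sum.inr_ne_inl
        · exact ⟨v, Relation.ReflTransGen.refl, i, j', h2⟩
      | head hstep _ ih =>
        rintro v rfl
        obtain ⟨a, b, hab⟩ := hstep
        have h1 := he (Sum.inl (v, a))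
        rw [stuHalfEdge_inl, hab] at h1
        rcases h2 : e (Sum.inl (v, a)) with ⟨v', i'⟩ | j'
        · rw [h2, stuHalfEdge_inl] at h1
          obtain ⟨w', hw', hw''⟩ := ih v' (congrArg Prod.fst (Sum.inl.inj h1))
          exact ⟨w', Relation.ReflTransGen.head ⟨a, i', h2⟩ hw', hw''⟩
        · exact ⟨v, Relation.ReflTransGen.refl, a, j', h2⟩
    exact key _ hw v rfl

/-- Induction on the number of vertices off the circle: STU at a vertex next to the circle expresses
the diagram by two diagrams with one vertex less. -/
theorem Diagram.toTrivalent_mem_range {k m : ℕ} (D : Diagram k m) :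
    D.toTrivalent ∈ LinearMap.range chordCombinationClass := by
  induction k generalizing m with
  | zero =>
    have h1 : ∀ i : Fin m, ∃ j, D.edge (Sum.inr i) = Sum.inr j := by
      intro i
      rcases D.edge (Sum.inr i) with ⟨v, _⟩ | j
      · exact v.elim0
      · exact ⟨j, rfl⟩
    choose f hf using h1
    have h2 : ∃ C : ChordDiagram m, C.toDiagram = D := by
      refine ⟨⟨f, fun i => ?_, fun i hi => ?_⟩, ?_⟩
      · apply Sum.inr_injective (α := Fin 0 × Fin 3)
        rw [← hf, ← hf, D.edge_edge]
      · apply D.edge_ne (Sum.inr i)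
        rw [hf, hi]
      · rcases D with ⟨e, _, _, _⟩
        simp only [ChordDiagram.toDiagram, Diagram.mk.injEq]
        ext (⟨v, _⟩ | i)
        · exact v.elim0
        · exact (hf i).symm
    obtain ⟨C, rfl⟩ := h2
    exact ⟨Finsupp.single ⟨m, C⟩ 1, by simp [chordCombinationClass]⟩
  | succ k ih =>
    rcases m with _ | m
    · obtain ⟨w, -, i, j, -⟩ := D.reach 0
      exact j.elim0
    · obtain ⟨S, hS, hS'⟩ := D.exists_iso_edge_last
      obtain ⟨T, hT⟩ := S.exists_isMerge hS'
      rw [Diagram.toTrivalent_eq_of_iso hS, hT.toTrivalent_eq]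
      exact Submodule.sub_mem _ (ih T) (ih _)

theorem Diagram.average_mem_range {k m : ℕ} (D : Diagram k m) :
    D.average ∈ LinearMap.range chordCombinationClass :=
  Submodule.smul_mem _ _ (Submodule.sum_mem _ fun _ _ => Diagram.toTrivalent_mem_range _)

theorem trivalentWeight_average {k m : ℕ} (D : Diagram k m) :
    trivalentWeight D.average =
      ((m ! : ℂ)⁻¹) • ∑ σ : Equiv.Perm (Fin m), (D.permuteLegs σ).weight := by
  rw [Diagram.average, map_smul, map_sum]
  simp only [trivalentWeight_toTrivalent]

theorem Diagram.hasWeight_trivalentWeight {k m : ℕ} (D : Diagram k m) :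
    D.HasWeight (trivalentWeight D.average) := by
  refine ⟨LinearMap.mem_range.1 D.average_mem_range, fun a ha => ?_⟩
  rw [← ha, trivalentWeight_chordCombinationClass]

/-! ### Closed paths and traces -/

theorem matrix_prod_ofFn_apply {ι R : Type*} [Fintype ι] [DecidableEq ι] [CommSemiring R] {m : ℕ}
    (A : Fin (m + 1) → Matrix ι ι R) (i j : ι) :
    (List.ofFn A).prod i j = ∑ r : Fin m → ι,
      ∏ v, A v ((Fin.cons i r : Fin (m + 1) → ι) v) ((Fin.snoc r j : Fin (m + 1) → ι) v) := by
  induction m generalizing i with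
  | zero => simp [Fin.snoc]
  | succ m ih =>
    rw [List.ofFn_succ, List.prod_cons, Matrix.mul_apply, sum_cons]
    refine Finset.sum_congr rfl fun a _ => ?_
    rw [ih, Finset.mul_sum]
    refine Finset.sum_congr rfl fun r _ => ?_
    rw [Fin.prod_univ_succ (n := m + 1), ← Fin.cons_snoc_eq_snoc_cons]
    simp

/-- The trace sums over closed paths. Here `r v` is the state after step `v`, so the state before
step `0` is the last entry of `r`. -/
theorem sum_prod_finRotate_eq_trace {ι R : Type*} [Fintype ι] [DecidableEq ι] [CommSemiring R]
    {m : ℕ} (A : Fin (m + 1) → Matrix ι ι R) :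
    ∑ r : Fin (m + 1) → ι, ∏ v, A v (r ((finRotate (m + 1)).symm v)) (r v) =
      (List.ofFn A).prod.trace := by
  rw [Matrix.trace, ← (Fin.snocEquiv fun _ : Fin (m + 1) => ι).sum_comp, Fintype.sum_prod_type]
  refine Finset.sum_congr rfl fun i _ => ?_
  rw [Matrix.diag_apply, matrix_prod_ofFn_apply]
  refine Finset.sum_congr rfl fun r _ => Finset.prod_congr rfl fun v _ => ?_
  congr 1
  refine Fin.cases ?_ (fun v => ?_) v
  · have h : (finRotate (m + 1)).symm 0 = Fin.last m := by
      rw [Equiv.symm_apply_eq, finRotate_last]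
    simp [h, Fin.snocEquiv]
  · have h : (finRotate (m + 1)).symm v.succ = v.castSucc := by
      rw [Equiv.symm_apply_eq, finRotate_apply, Fin.coeSucc_eq_succ]
    simp [h, Fin.snocEquiv]

/-! ### The tensor of a wheel -/

/-- A trivalent vertex as a matrix from the previous to the next edge of the rim. -/
def vertexMatrix (a : Fin 3) : Matrix (Fin 3) (Fin 3) ℂ :=
  Matrix.of fun r' r => vertexTensor a r r'

/-- With the leg labels `p` fixed, the sum over the labels of the rim is a sum over closed paths.
The case `m = 0` is excluded because the trace of the empty word is `3`, whereas the empty diagram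
has weight `1`. -/
theorem contract_wheel {M : Type*} [AddCommGroup M] [Module ℂ M] {m : ℕ} (hm : m ≠ 0)
    (G : (Fin m → Fin 3) → M) :
    (wheel m).contract G = ∑ p : Fin m → Fin 3, (word vertexMatrix p).trace • G p := by
  obtain ⟨m, rfl⟩ := Nat.exists_eq_succ_of_ne_zero hm
  have h1 : ∀ p : Fin (m + 1) → Fin 3, (word vertexMatrix p).trace =
      ∑ r : Fin (m + 1) → Fin 3, ∏ v,
        vertexTensor (p v) (r v) (r ((finRotate (m + 1)).symm v)) := fun p =>
    (sum_prod_finRotate_eq_trace fun v => vertexMatrix (p v)).symm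
  simp only [h1, Finset.sum_smul]
  rw [← Fintype.sum_prod_type', Diagram.contract]
  have hinv : ∀ l : HalfEdge (m + 1) (m + 1) → Fin 3,
      (∀ h, l ((wheel (m + 1)).edge h) = l h) → ∀ v, l (Sum.inr v) = l (Sum.inl (v, 0)) ∧
        l (Sum.inl ((finRotate (m + 1)).symm v, 1)) = l (Sum.inl (v, 2)) :=
    fun l hl v => ⟨hl (Sum.inl (v, 0)), hl (Sum.inl (v, 2))⟩
  refine Finset.sum_bij' (fun l _ => (fun v => l (Sum.inr v), fun v => l (Sum.inl (v, 1))))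
    (fun x _ => Sum.elim (fun u => ![x.1 u.1, x.2 u.1, x.2 ((finRotate (m + 1)).symm u.1)] u.2) x.1)
    ?_ ?_ ?_ ?_ ?_
  · intro l _; exact Finset.mem_univ _
  · rintro ⟨p, r⟩ _
    simp only [Finset.mem_filter, Finset.mem_univ, true_and]
    rintro (⟨v, i⟩ | v)
    · fin_cases i
      · rfl
      · change r ((finRotate (m + 1)).symm (finRotate (m + 1) v)) = r v
        rw [Equiv.symm_apply_apply]
      · rfl
    · rfl
  · intro l hl
    simp only [Finset.mem_filter, Finset.mem_univ, true_and] at hl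
    have h2 := hinv l hl
    ext (⟨v, i⟩ | v)
    · fin_cases i
      · simp [(h2 v).1]
      · simp
      · exact congrArg Fin.val (h2 v).2
    · simp
  · rintro ⟨p, r⟩ _
    rfl
  · intro l hl
    simp only [Finset.mem_filter, Finset.mem_univ, true_and] at hl
    have h2 := hinv l hl
    congr 1
    refine Finset.prod_congr rfl fun v _ => ?_
    rw [← (h2 v).1, ← (h2 v).2]

/-- Up to the factor $-i\sqrt2$ the matrix is the cross product with $y$, so its eigenvalues are $0$
and $\pm\sqrt{2\,y\cdot y}$. The eigenvalue $0$ is the reason for `n ≠ 0`. The computation uses the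
relation $B^4=-(y\cdot y)B^2$ instead of eigenvalues. -/
theorem trace_sum_smul_vertexMatrix_pow (y : Fin 3 → ℂ) {n : ℕ} (hn : n ≠ 0) :
    ((∑ a, y a • vertexMatrix a) ^ (2 * n)).trace = 2 ^ (n + 1) * (∑ a, y a * y a) ^ n := by
  obtain ⟨n, rfl⟩ := Nat.exists_eq_succ_of_ne_zero hn
  have hs := sqrtTwo_mul_self
  have hI := Complex.I_mul_I
  set N : ℂ := ∑ a, y a * y a with hN
  set B : Matrix (Fin 3) (Fin 3) ℂ := !![0, -y 2, y 1; y 2, 0, -y 0; -y 1, y 0, 0] with hB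
  have hA : ∑ a, y a • vertexMatrix a = (-(Complex.I * sqrtTwo)) • B := by
    ext i j
    fin_cases i <;> fin_cases j <;>
      simp [hB, vertexMatrix, vertexTensor, leviCivita, Fin.sum_univ_three, mul_comm]
  have hB3 : B * B * (B * B) = (-N) • (B * B) := by
    ext i j
    fin_cases i <;> fin_cases j <;>
      simp [hB, hN, Matrix.mul_apply, Fin.sum_univ_three] <;> ring
  have hA2 : ((-(Complex.I * sqrtTwo)) • B) ^ 2 = (-2 : ℂ) • (- -(B * B)) := by
    rw [sq, smul_mul_smul_comm, neg_neg]
    congr 1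
    linear_combination (sqrtTwo * sqrtTwo) * hI - hs
  have hpow : ∀ k : ℕ, (((-2 : ℂ) • (B * B)) ^ (k + 1)) = ((2 * N) ^ k * -2) • (B * B) := by
    intro k
    induction k with
    | zero => simp
    | succ k ih =>
      rw [pow_succ, ih, smul_mul_smul_comm, hB3, smul_smul]
      congr 1
      ring
  have htr : (B * B).trace = -2 * N := by
    simp [hB, hN, Matrix.trace_fin_three, Fin.sum_univ_three]
    ring
  rw [hA, pow_mul, hA2, neg_neg, hpow, Matrix.trace_smul, htr, smul_eq_mul, Nat.succ_eq_add_one]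
  ring

/-! ### The sum of the chord diagrams -/

/-- The sum of the weights of the chord diagrams `D(σ)`. -/
def chordSum (n : ℕ) : USlTwo :=
  ∑ σ : Equiv.Perm (Fin (2 * n)), chordWeight (permChordDiagram n σ)

theorem chordSum_eq (n : ℕ) : chordSum n = ∑ p : Fin (2 * n) → Fin 3,
    (∑ σ : Equiv.Perm (Fin (2 * n)), pairDelta n (p ∘ σ)) • word orthoGen p := by
  simp only [Finset.sum_smul]
  rw [Finset.sum_comm, chordSum]
  refine Finset.sum_congr rfl fun σ _ => ?_
  rw [ChordDiagram.chordWeight_eq, Finset.sum_filter]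
  refine Finset.sum_congr rfl fun p _ => ?_
  have h : (∀ i, p ((permChordDiagram n σ).mate i) = p i) ↔
      ∀ i, (p ∘ σ) (standardMate n i) = (p ∘ σ) i := by
    rw [← σ.forall_congr_right]
    simp [permChordDiagram]
  simp only [pairDelta, h]
  split_ifs <;> simp

theorem commute_chordSum (n : ℕ) (s : Fin 3) : Commute (orthoGen s) (chordSum n) := by
  refine Commute.sum_right _ _ _ fun σ _ => ?_
  rw [← ChordDiagram.weight_toDiagram]
  exact Diagram.commute_weight _ s

/-- Moving a symmetrization from one factor to the other. -/
theorem sum_sum_perm_smul {M : Type*} [AddCommGroup M] [Module ℂ M] {m : ℕ}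
    (f : (Fin m → Fin 3) → ℂ) (g : (Fin m → Fin 3) → M) :
    ∑ p, (∑ σ : Equiv.Perm (Fin m), f (p ∘ σ)) • g p =
      ∑ p, f p • ∑ σ : Equiv.Perm (Fin m), g (p ∘ σ) := by
  simp only [Finset.sum_smul, Finset.smul_sum]
  rw [Finset.sum_comm, Finset.sum_comm (s := Finset.univ (α := Fin m → Fin 3)),
    ← Equiv.sum_comp (Equiv.inv (Equiv.Perm (Fin m)))]
  refine Finset.sum_congr rfl fun σ _ => ?_
  rw [← (Equiv.arrowCongr σ (Equiv.refl (Fin 3))).symm.sum_comp]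
  refine Finset.sum_congr rfl fun p _ => ?_
  congr 2
  ext i
  simp [Equiv.arrowCongr]

/-- The symmetrization over leg placements is moved from the words to the coefficients. There the
symmetrized trace tensor equals $2^{n+1}$ times the symmetrized pairing, since their polynomials are
so related. -/
theorem trivalentWeight_average_wheel {n : ℕ} (hn : n ≠ 0) :
    trivalentWeight (wheel (2 * n)).average =
      (((2 * n)! : ℂ)⁻¹ * 2 ^ (n + 1)) • chordSum n := by
  rw [trivalentWeight_average, mul_smul]
  congr 1
  have h1 : ∀ σ : Equiv.Perm (Fin (2 * n)), ((wheel (2 * n)).permuteLegs σ).weight =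
      ∑ p : Fin (2 * n) → Fin 3, (word vertexMatrix p).trace •
        word orthoGen (p ∘ (σ⁻¹ : Equiv.Perm (Fin (2 * n)))) := by
    intro σ
    rw [Diagram.weight, Diagram.contract_permuteLegs, contract_wheel (by omega)]
    rfl
  simp only [h1]
  refine (Equiv.sum_comp (Equiv.inv (Equiv.Perm (Fin (2 * n)))) (fun σ =>
    ∑ p : Fin (2 * n) → Fin 3,
      (word vertexMatrix p).trace • word orthoGen (p ∘ σ))).trans ?_
  rw [Finset.sum_comm]
  simp only [← Finset.smul_sum]
  rw [← sum_sum_perm_smul, chordSum_eq, Finset.smul_sum]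
  refine Finset.sum_congr rfl fun p _ => ?_
  rw [smul_smul]
  congr 1
  exact sum_perm_map_word vertexMatrix (Matrix.traceLinearMap (Fin 3) ℂ ℂ) n _
    (fun y => trace_sum_smul_vertexMatrix_pow y hn) p

attribute [local instance] LieRing.ofAssociativeRing LieAlgebra.ofAssociativeAlgebra

/-! ### The enveloping algebra and its spanning monomials -/

theorem slTwo_eq (v : SlTwo) :
    v = v.val 0 1 • slE + v.val 0 0 • slH + v.val 1 0 • slF := by
  have hv : v.val 0 0 + v.val 1 1 = 0 := by
    have h := v.property
    simpa [LieAlgebra.SpecialLinear.sl, Matrix.trace_fin_two] using h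
  apply Subtype.ext
  ext i j
  fin_cases i <;> fin_cases j <;> simp [slE, slH, slF]
  linear_combination hv

/-- The generator `e` of `U(sl_2)`. -/
def genE : USlTwo := UniversalEnvelopingAlgebra.ι ℂ slE

/-- The generator `h` of `U(sl_2)`. -/
def genH : USlTwo := UniversalEnvelopingAlgebra.ι ℂ slH

/-- The generator `f` of `U(sl_2)`. -/
def genF : USlTwo := UniversalEnvelopingAlgebra.ι ℂ slF

theorem ι_eq (v : SlTwo) : UniversalEnvelopingAlgebra.ι ℂ v =
    v.val 0 1 • genE + v.val 0 0 • genH + v.val 1 0 • genF := by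
  conv_lhs => rw [slTwo_eq v]
  simp [genE, genH, genF]

theorem genE_mul_genF : genE * genF = genF * genE + genH := by
  have h := ι_lie slE slF
  rw [lie_slE_slF] at h
  rw [genE, genF, genH, h]
  abel

theorem genH_mul_genE : genH * genE = genE * genH + (2 : ℂ) • genE := by
  have h := ι_lie slH slE
  rw [lie_slH_slE, map_smul] at h
  rw [genE, genH, h]
  abel

theorem genH_mul_genF : genH * genF = genF * genH - (2 : ℂ) • genF := by
  have h := ι_lie slH slF
  rw [lie_slH_slF, map_smul, neg_smul, eq_comm, sub_eq_iff_eq_add] at h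
  rw [genF, genH, h]
  abel

/-- The universal property lifts the inclusion of $sl_2$ into the subalgebra to a map from
$U(sl_2)$; followed by the inclusion it is the identity, by uniqueness. -/
theorem adjoin_gen_eq_top : Algebra.adjoin ℂ {genE, genH, genF} = ⊤ := by
  set S := Algebra.adjoin ℂ {genE, genH, genF} with hS
  have hmem : ∀ v : SlTwo, UniversalEnvelopingAlgebra.ι ℂ v ∈ S := by
    intro v
    rw [ι_eq]
    exact add_mem (add_mem (S.smul_mem (Algebra.subset_adjoin (by simp)) _)
      (S.smul_mem (Algebra.subset_adjoin (by simp)) _))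
      (S.smul_mem (Algebra.subset_adjoin (by simp)) _)
  let f : SlTwo →ₗ⁅ℂ⁆ S :=
    { toFun := fun v => ⟨UniversalEnvelopingAlgebra.ι ℂ v, hmem v⟩
      map_add' := fun v w => Subtype.ext (map_add _ v w)
      map_smul' := fun c v => Subtype.ext (map_smul _ c v)
      map_lie' := fun {v w} => Subtype.ext (ι_lie v w) }
  have hf : S.val.comp (UniversalEnvelopingAlgebra.lift ℂ f) = AlgHom.id ℂ USlTwo := by
    apply UniversalEnvelopingAlgebra.hom_ext
    ext v
    change ((UniversalEnvelopingAlgebra.lift ℂ f (UniversalEnvelopingAlgebra.ι ℂ v) : S) : USlTwo) =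
      UniversalEnvelopingAlgebra.ι ℂ v
    rw [UniversalEnvelopingAlgebra.lift_ι_apply]
    rfl
  rw [eq_top_iff]
  intro u _
  have h := AlgHom.congr_fun hf u
  rw [AlgHom.id_apply] at h
  rw [← h]
  exact (UniversalEnvelopingAlgebra.lift ℂ f u).2

open Polynomial in
theorem genH_mul_genF_pow (a : ℕ) :
    genH * genF ^ a = genF ^ a * aeval genH (X - C (2 * a : ℂ)) := by
  induction a with
  | zero => simp
  | succ a ih =>
    rw [pow_succ, ← mul_assoc, ih]
    simp only [map_sub, aeval_X, aeval_C, Algebra.algebraMap_eq_smul_one, mul_assoc, sub_mul,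
      genH_mul_genF]
    simp only [mul_sub, smul_mul_assoc, mul_smul_comm, one_mul, mul_one]
    push_cast
    module

open Polynomial in
theorem genE_mul_genF_pow (a : ℕ) :
    genE * genF ^ a = genF ^ a * genE + (a : ℂ) • (genF ^ (a - 1) *
      aeval genH (X - C (a - 1 : ℂ))) := by
  induction a with
  | zero => simp
  | succ a ih =>
    have h1 : (a : ℂ) • (genF ^ (a - 1) * genF) = (a : ℂ) • genF ^ a := by
      cases a with
      | zero => simp
      | succ a => rw [Nat.add_sub_cancel, pow_succ]
    rw [pow_succ, ← mul_assoc, ih, add_mul, mul_assoc, genE_mul_genF, smul_mul_assoc, mul_assoc]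
    have h2 : aeval genH (X - C (a - 1 : ℂ)) * genF =
        genF * aeval genH (X - C (a + 1 : ℂ)) := by
      simp only [map_sub, aeval_X, aeval_C, Algebra.algebraMap_eq_smul_one, sub_mul,
        genH_mul_genF, mul_sub, smul_mul_assoc, mul_smul_comm, one_mul, mul_one]
      module
    rw [h2, ← mul_assoc (genF ^ (a - 1)), ← smul_mul_assoc, h1, Nat.add_sub_cancel]
    simp only [map_sub, aeval_X, aeval_C, Algebra.algebraMap_eq_smul_one, mul_sub, mul_add,
      smul_mul_assoc, mul_smul_comm, mul_one, mul_assoc]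
    push_cast
    module

open Polynomial in
theorem genE_mul_aeval (P : ℂ[X]) :
    genE * aeval genH P = aeval genH (P.comp (X - C 2)) * genE := by
  have h : genE * genH = aeval genH (X - C 2 : ℂ[X]) * genE := by
    simp only [map_sub, aeval_X, aeval_C, Algebra.algebraMap_eq_smul_one, sub_mul, genH_mul_genE,
      smul_mul_assoc, one_mul]
    abel
  induction P using Polynomial.induction_on' with
  | add P Q hP hQ => rw [map_add, mul_add, hP, hQ, add_comp, map_add, add_mul]
  | monomial n c =>
    rw [← C_mul_X_pow_eq_monomial, mul_comp, C_comp, pow_comp, X_comp, map_mul, map_mul, map_pow,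
      map_pow, aeval_X, aeval_C, ← mul_assoc, ← Algebra.commutes, mul_assoc, mul_assoc]
    congr 1
    exact SemiconjBy.pow_right h n

open Polynomial in
/-- The combination of the ordered monomials `f ^ a * P(h) * e ^ c`. -/
def orderedSum : (ℕ × ℕ →₀ ℂ[X]) →ₗ[ℂ] USlTwo :=
  Finsupp.lsum ℂ fun x => (LinearMap.mulLeft ℂ (genF ^ x.1)).comp
    ((LinearMap.mulRight ℂ (genE ^ x.2)).comp (aeval genH).toLinearMap)

open Polynomial in
theorem orderedSum_single (a c : ℕ) (P : ℂ[X]) :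
    orderedSum (Finsupp.single (a, c) P) = genF ^ a * (aeval genH P * genE ^ c) := by
  simp [orderedSum]

open Polynomial in
-- The spanning half of the Poincaré–Birkhoff–Witt theorem: the range contains `1` and is stable
-- under left multiplication by the generators. Linear independence is not needed.
theorem orderedSum_surjective : Function.Surjective orderedSum := by
  rw [← LinearMap.range_eq_top]
  set R := LinearMap.range orderedSum with hR
  have hmul : ∀ g : USlTwo, (∀ a c P, g * orderedSum (Finsupp.single (a, c) P) ∈ R) →
      ∀ u ∈ R, g * u ∈ R := by
    rintro g hg _ ⟨w, rfl⟩
    induction w using Finsupp.induction_linear with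
    | zero => simp
    | add v w hv hw => rw [map_add, mul_add]; exact add_mem hv hw
    | single x P => exact hg x.1 x.2 P
  have hF : ∀ u ∈ R, genF * u ∈ R := hmul _ fun a c P =>
    ⟨Finsupp.single (a + 1, c) P, by
      rw [orderedSum_single, orderedSum_single, pow_succ', mul_assoc]⟩
  have hH : ∀ u ∈ R, genH * u ∈ R := hmul _ fun a c P =>
    ⟨Finsupp.single (a, c) ((X - C (2 * a : ℂ)) * P), by
      rw [orderedSum_single, orderedSum_single, ← mul_assoc genH, genH_mul_genF_pow, map_mul]
      simp only [mul_assoc]⟩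
  have hE : ∀ u ∈ R, genE * u ∈ R := hmul _ fun a c P =>
    ⟨Finsupp.single (a, c + 1) (P.comp (X - C 2)) +
      Finsupp.single (a - 1, c) ((a : ℂ) • ((X - C (a - 1 : ℂ)) * P)), by
      rw [map_add, orderedSum_single, orderedSum_single, orderedSum_single, ← mul_assoc genE,
        genE_mul_genF_pow, map_smul, map_mul, add_mul, mul_assoc (genF ^ a) genE,
        ← mul_assoc genE, genE_mul_aeval, pow_succ']
      simp only [mul_assoc, smul_mul_assoc, mul_smul_comm]⟩
  have hone : (1 : USlTwo) ∈ R := ⟨Finsupp.single (0, 0) 1, by simp [orderedSum_single]⟩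
  have hall : ∀ x : USlTwo, ∀ u ∈ R, x * u ∈ R := by
    intro x
    have hx : x ∈ Algebra.adjoin ℂ {genE, genH, genF} := by
      rw [adjoin_gen_eq_top]; trivial
    induction hx using Algebra.adjoin_induction with
    | mem x hx =>
      rcases hx with rfl | rfl | rfl
      · exact hE
      · exact hH
      · exact hF
    | algebraMap c =>
      intro u hu
      rw [← Algebra.smul_def]
      exact R.smul_mem c hu
    | add x y _ _ hx hy =>
      intro u hu
      rw [add_mul]
      exact add_mem (hx u hu) (hy u hu)
    | mul x y _ _ hx hy =>
      intro u hu
      rw [mul_assoc]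
      exact hx _ (hy u hu)
  rw [eq_top_iff]
  intro x _
  simpa using hall x 1 hone

/-! ### The representations on polynomials -/

open Polynomial

/-- The action of `e` on polynomials. -/
def opE : Module.End ℂ ℂ[X] := derivative

/-- The action of `h` on polynomials, with highest weight `lam`. -/
def opH (lam : ℂ) : Module.End ℂ ℂ[X] :=
  lam • LinearMap.id - (2 : ℂ) • (LinearMap.mulLeft ℂ X ∘ₗ derivative)

/-- The action of `f` on polynomials, with highest weight `lam`. -/
def opF (lam : ℂ) : Module.End ℂ ℂ[X] :=
  lam • LinearMap.mulLeft ℂ X - LinearMap.mulLeft ℂ (X * X) ∘ₗ derivative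

theorem opE_apply (p : ℂ[X]) : opE p = derivative p := rfl

theorem opH_apply (lam : ℂ) (p : ℂ[X]) :
    opH lam p = C lam * p - 2 * (X * derivative p) := by
  simp only [opH, LinearMap.sub_apply, LinearMap.smul_apply, LinearMap.id_apply,
    LinearMap.comp_apply, LinearMap.mulLeft_apply, smul_eq_C_mul, map_ofNat]

theorem opF_apply (lam : ℂ) (p : ℂ[X]) :
    opF lam p = C lam * (X * p) - X * X * derivative p := by
  simp [opF, smul_eq_C_mul, mul_assoc]

/-- The representation of `sl_2` on polynomials, with highest weight `lam`. -/
def polyRep (lam : ℂ) : SlTwo →ₗ⁅ℂ⁆ Module.End ℂ ℂ[X] where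
  toFun v := v.val 0 1 • opE + v.val 0 0 • opH lam + v.val 1 0 • opF lam
  map_add' v w := by
    have h : (v + w).val = v.val + w.val := rfl
    simp only [h, Matrix.add_apply]
    module
  map_smul' c v := by
    have h : (c • v).val = c • v.val := rfl
    simp only [h, Matrix.smul_apply, smul_eq_mul, RingHom.id_apply]
    module
  map_lie' {v w} := by
    have hv : v.val 1 1 = -v.val 0 0 := by
      have h := v.property
      rw [eq_neg_iff_add_eq_zero, add_comm]
      simpa [LieAlgebra.SpecialLinear.sl, Matrix.trace_fin_two] using h
    have hw : w.val 1 1 = -w.val 0 0 := by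
      have h := w.property
      rw [eq_neg_iff_add_eq_zero, add_comm]
      simpa [LieAlgebra.SpecialLinear.sl, Matrix.trace_fin_two] using h
    refine LinearMap.ext fun p => ?_
    simp only [LieSubalgebra.coe_bracket, Ring.lie_def, Matrix.sub_apply, Matrix.mul_apply,
      Fin.sum_univ_two, hv, hw, LinearMap.add_apply, LinearMap.sub_apply, LinearMap.smul_apply,
      Module.End.mul_apply, map_add, opE_apply, opH_apply, opF_apply, smul_eq_C_mul,
      derivative_mul, derivative_sub, derivative_C, derivative_X,
      C_sub, C_mul, C_neg, derivative_ofNat]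
    ring

/-- The representation of `U(sl_2)` on polynomials. -/
def uRep (lam : ℂ) : USlTwo →ₐ[ℂ] Module.End ℂ ℂ[X] :=
  UniversalEnvelopingAlgebra.lift ℂ (polyRep lam)

theorem uRep_ι (lam : ℂ) (v : SlTwo) : uRep lam (UniversalEnvelopingAlgebra.ι ℂ v) =
    v.val 0 1 • opE + v.val 0 0 • opH lam + v.val 1 0 • opF lam :=
  UniversalEnvelopingAlgebra.lift_ι_apply ℂ (polyRep lam) v

theorem uRep_genE (lam : ℂ) : uRep lam genE = opE := by
  rw [genE, uRep_ι]
  simp [slE]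

theorem uRep_genH (lam : ℂ) : uRep lam genH = opH lam := by
  rw [genH, uRep_ι]
  simp [slH]

theorem uRep_genF (lam : ℂ) : uRep lam genF = opF lam := by
  rw [genF, uRep_ι]
  simp [slF]

theorem opF_X_pow (lam : ℂ) (k : ℕ) : opF lam (X ^ k) = (lam - k) • X ^ (k + 1) := by
  have h : (k : ℂ[X]) * (X : ℂ[X]) ^ (k - 1) * X = (k : ℂ[X]) * X ^ k := by
    cases k with
    | zero => simp
    | succ k => rw [Nat.add_sub_cancel, pow_succ, mul_assoc]
  rw [opF_apply, derivative_X_pow, smul_eq_C_mul, C_sub]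
  simp only [map_natCast]
  rw [pow_succ]
  linear_combination (-X : ℂ[X]) * h

theorem opF_pow_one (lam : ℂ) (a : ℕ) :
    ((opF lam) ^ a) 1 = (∏ i ∈ Finset.range a, (lam - i)) • (X ^ a : ℂ[X]) := by
  induction a with
  | zero => simp
  | succ a ih =>
    rw [pow_succ', Module.End.mul_apply, ih, map_smul, opF_X_pow, smul_smul,
      Finset.prod_range_succ]

theorem aeval_opH_one (lam : ℂ) (P : ℂ[X]) : (aeval (opH lam) P) 1 = C (P.eval lam) := by
  induction P using Polynomial.induction_on' with
  | add P Q hP hQ => rw [map_add, LinearMap.add_apply, hP, hQ, eval_add, C_add]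
  | monomial n c =>
    have h : ∀ n : ℕ, (opH lam ^ n) 1 = C (lam ^ n) := by
      intro n
      induction n with
      | zero => simp
      | succ n ih =>
        rw [pow_succ', Module.End.mul_apply, ih, opH_apply, derivative_C, ← C_mul, ← pow_succ']
        simp
    rw [aeval_monomial, Module.End.mul_apply, h, Module.algebraMap_end_apply, eval_monomial,
      smul_eq_C_mul, ← C_mul]

theorem opE_pow_X_pow_self (k : ℕ) : (opE ^ k) (X ^ k) = C (k ! : ℂ) := by
  have h : ∀ p : ℂ[X], (opE ^ k) p = derivative^[k] p := fun p => by
    rw [Module.End.coe_pow]; rfl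
  rw [h, iterate_derivative_X_pow_eq_natCast_mul, Nat.descFactorial_self]
  simp

theorem opE_pow_X_pow_of_lt {k c : ℕ} (hkc : k < c) : (opE ^ c) (X ^ k) = 0 := by
  have h : ∀ p : ℂ[X], (opE ^ c) p = derivative^[c] p := fun p => by
    rw [Module.End.coe_pow]; rfl
  rw [h, iterate_derivative_eq_zero]
  simpa using hkc

/-- The finite-dimensional representations separate the points of `U(sl_2)`. -/
theorem eq_zero_of_uRep (z : USlTwo)
    (hz : ∀ d : ℕ, ∀ k < d + 1, uRep (d : ℂ) z (X ^ k) = 0) : z = 0 := by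
  obtain ⟨w, rfl⟩ := orderedSum_surjective z
  suffices hw : w = 0 by rw [hw, map_zero]
  by_contra hw
  -- Test on `X ^ c₀` with the least exponent `c₀` of `e`: larger powers of `e` kill it, and `e ^
  -- c₀` turns it into a constant, on which `P(h)` is evaluation at `d` and `f ^ a` gives a multiple
  -- of `X ^ a`. The coefficient of `X ^ a₀` isolates a single term.
  obtain ⟨⟨a₀, c₀⟩, hx₀, hmin⟩ := Finset.exists_min_image w.support Prod.snd
    (Finsupp.support_nonempty_iff.2 hw)
  have hmin' : ∀ x ∈ w.support, c₀ ≤ x.2 := hmin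
  have hact : ∀ d : ℕ, uRep (d : ℂ) (orderedSum w) (X ^ c₀) =
      ∑ x ∈ w.support, (opF d ^ x.1) ((aeval (opH d) (w x)) ((opE ^ x.2) (X ^ c₀))) := by
    intro d
    rw [orderedSum, Finsupp.lsum_apply, Finsupp.sum, map_sum, LinearMap.sum_apply]
    refine Finset.sum_congr rfl fun x _ => ?_
    simp only [LinearMap.comp_apply, LinearMap.mulLeft_apply, LinearMap.mulRight_apply,
      AlgHom.toLinearMap_apply, map_mul, map_pow, Module.End.mul_apply, uRep_genE, uRep_genF]
    rw [← uRep_genH, aeval_algHom_apply]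
  have hterm : ∀ d : ℕ, ∀ x ∈ w.support,
      ((opF d ^ x.1) ((aeval (opH d) (w x)) ((opE ^ x.2) (X ^ c₀)))).coeff a₀ =
        if x = (a₀, c₀) then (c₀ ! : ℂ) * ((w x).eval (d : ℂ) *
          ∏ i ∈ Finset.range a₀, ((d : ℂ) - i)) else 0 := by
    rintro d ⟨a, c⟩ hx
    rcases (hmin' _ hx).lt_or_eq with hc | hc
    · dsimp only at hc ⊢
      rw [opE_pow_X_pow_of_lt hc, if_neg]
      · simp
      · intro h
        exact hc.ne' (congrArg Prod.snd h)
    · dsimp only at hc ⊢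
      subst hc
      have h1 : (C (c₀ ! : ℂ) : ℂ[X]) = (c₀ ! : ℂ) • 1 := by rw [smul_eq_C_mul, mul_one]
      rw [opE_pow_X_pow_self, h1, map_smul, map_smul, aeval_opH_one]
      have h2 : (C ((w (a, c₀)).eval (d : ℂ)) : ℂ[X]) = (w (a, c₀)).eval (d : ℂ) • 1 := by
        rw [smul_eq_C_mul, mul_one]
      rw [h2, map_smul, opF_pow_one]
      simp only [coeff_smul, coeff_X_pow, smul_eq_mul, Prod.mk.injEq, and_true]
      by_cases ha : a = a₀
      · subst ha
        simp
      · rw [if_neg (Ne.symm ha), if_neg ha]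
        simp
  -- `c₀ ≤ d` puts the test vector into the representation, and `a₀ ≤ d` keeps the factor from `f ^
  -- a₀` nonzero.
  have hroot : ∀ d : ℕ, max a₀ c₀ ≤ d → (w (a₀, c₀)).eval (d : ℂ) = 0 := by
    intro d hd
    have h1 := congrArg (fun p : ℂ[X] => p.coeff a₀)
      ((hact d).symm.trans (hz d c₀ (by have := le_max_right a₀ c₀; omega)))
    rw [finsetSum_coeff, Finset.sum_congr rfl (hterm d), Finset.sum_ite_eq' , if_pos hx₀,
      coeff_zero] at h1
    have h2 : ∏ i ∈ Finset.range a₀, ((d : ℂ) - i) ≠ 0 := by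
      rw [Finset.prod_ne_zero_iff]
      intro i hi
      rw [sub_ne_zero]
      have := le_max_left a₀ c₀
      have := Finset.mem_range.1 hi
      exact_mod_cast (show d ≠ i by omega)
    have h3 : (c₀ ! : ℂ) ≠ 0 := by exact_mod_cast Nat.factorial_ne_zero _
    simpa [h2, h3] using h1
  apply Finsupp.mem_support_iff.1 hx₀
  apply Polynomial.eq_zero_of_infinite_isRoot
  refine Set.Infinite.mono (s := (fun d : ℕ => (d : ℂ)) '' Set.Ici (max a₀ c₀)) ?_ ?_
  · rintro _ ⟨d, hd, rfl⟩
    exact hroot d hd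
  · exact (Set.Ici_infinite _).image (Nat.cast_injective.injOn)

/-! ### Traces on polynomials of bounded degree -/

/-- The operator preserves the space of polynomials of degree less than `d`. -/
def PreservesLT (d : ℕ) (A : Module.End ℂ ℂ[X]) : Prop :=
  ∀ p : ℂ[X], p.degree < d → (A p).degree < d

theorem PreservesLT.mul {d : ℕ} {A B : Module.End ℂ ℂ[X]} (hA : PreservesLT d A)
    (hB : PreservesLT d B) : PreservesLT d (A * B) := fun _ hp => hA _ (hB _ hp)

theorem PreservesLT.add {d : ℕ} {A B : Module.End ℂ ℂ[X]} (hA : PreservesLT d A)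
    (hB : PreservesLT d B) : PreservesLT d (A + B) := fun _ hp =>
  (degree_add_le _ _).trans_lt (max_lt (hA _ hp) (hB _ hp))

theorem PreservesLT.smul {d : ℕ} {A : Module.End ℂ ℂ[X]} (hA : PreservesLT d A) (c : ℂ) :
    PreservesLT d (c • A) := fun _ hp =>
  (degree_smul_le _ _).trans_lt (hA _ hp)

theorem preservesLT_pow {d : ℕ} {A : Module.End ℂ ℂ[X]} (hA : PreservesLT d A) (m : ℕ) :
    PreservesLT d (A ^ m) := by
  induction m with
  | zero => exact fun p hp => hp
  | succ m ih => rw [pow_succ]; exact ih.mul hA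

theorem preservesLT_opE (d : ℕ) : PreservesLT d opE := fun _ hp =>
  degree_derivative_le.trans_lt hp

theorem coeff_opE (p : ℂ[X]) (k : ℕ) : (opE p).coeff k = (k + 1) * p.coeff (k + 1) := by
  rw [opE_apply, coeff_derivative, mul_comm]

theorem coeff_opH (lam : ℂ) (p : ℂ[X]) (k : ℕ) :
    (opH lam p).coeff k = (lam - 2 * k) * p.coeff k := by
  rw [opH_apply, coeff_sub, coeff_C_mul, coeff_ofNat_mul]
  cases k with
  | zero => simp
  | succ k =>
    rw [coeff_X_mul, coeff_derivative]
    push_cast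
    ring

theorem coeff_opF_zero (lam : ℂ) (p : ℂ[X]) : (opF lam p).coeff 0 = 0 := by
  rw [opF_apply]
  simp [mul_coeff_zero]

theorem coeff_opF_succ (lam : ℂ) (p : ℂ[X]) (k : ℕ) :
    (opF lam p).coeff (k + 1) = (lam - k) * p.coeff k := by
  rw [opF_apply, coeff_sub, coeff_C_mul, coeff_X_mul, mul_assoc, coeff_X_mul]
  cases k with
  | zero => simp
  | succ k =>
    rw [coeff_X_mul, coeff_derivative]
    push_cast
    ring

theorem preservesLT_opH (lam : ℂ) (d : ℕ) : PreservesLT d (opH lam) := fun p hp => by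
  rw [degree_lt_iff_coeff_zero] at hp ⊢
  intro k hk
  rw [coeff_opH, hp k hk, mul_zero]

theorem preservesLT_opF (d : ℕ) : PreservesLT (d + 1) (opF d) := fun p hp => by
  rw [degree_lt_iff_coeff_zero] at hp ⊢
  intro k hk
  obtain ⟨k, rfl⟩ := Nat.exists_eq_succ_of_ne_zero (show k ≠ 0 by omega)
  rw [Nat.succ_eq_add_one, coeff_opF_succ]
  rcases Nat.lt_or_ge k (d + 1) with h | h
  · rw [show k = d by omega, sub_self, zero_mul]
  · rw [hp k h, mul_zero]

/-- The trace on polynomials of degree less than `d`. -/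
def traceLT (d : ℕ) : Module.End ℂ ℂ[X] →ₗ[ℂ] ℂ :=
  ∑ j ∈ Finset.range d, (lcoeff ℂ j).comp (LinearMap.applyₗ (X ^ j))

theorem traceLT_apply (d : ℕ) (A : Module.End ℂ ℂ[X]) :
    traceLT d A = ∑ j ∈ Finset.range d, (A (X ^ j)).coeff j := by
  simp [traceLT, LinearMap.sum_apply]

theorem traceLT_mul_eq {d : ℕ} {A B : Module.End ℂ ℂ[X]} (hB : PreservesLT d B) :
    traceLT d (A * B) = ∑ j ∈ Finset.range d, ∑ i ∈ Finset.range d,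
      (B (X ^ j)).coeff i * (A (X ^ i)).coeff j := by
  rw [traceLT_apply]
  refine Finset.sum_congr rfl fun j hj => ?_
  have h1 : (B (X ^ j)).degree < d := hB _ (by
    rw [degree_X_pow]
    exact_mod_cast Finset.mem_range.1 hj)
  have h2 : B (X ^ j) = ∑ i ∈ Finset.range d, (B (X ^ j)).coeff i • X ^ i := by
    ext k
    rw [finsetSum_coeff]
    simp only [coeff_smul, coeff_X_pow, smul_eq_mul, mul_ite, mul_one, mul_zero,
      Finset.sum_ite_eq, Finset.mem_range]
    split_ifs with h
    · rfl
    · exact degree_lt_iff_coeff_zero _ _ |>.1 h1 k (not_lt.1 h)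
  rw [Module.End.mul_apply]
  conv_lhs => rw [h2]
  rw [map_sum, finsetSum_coeff]
  simp

/-- The hypotheses make both truncations honest restrictions to an invariant finite-dimensional
subspace, where traces commute. -/
theorem traceLT_mul_comm {d : ℕ} {A B : Module.End ℂ ℂ[X]} (hA : PreservesLT d A)
    (hB : PreservesLT d B) : traceLT d (A * B) = traceLT d (B * A) := by
  rw [traceLT_mul_eq hB, traceLT_mul_eq hA, Finset.sum_comm]
  exact Finset.sum_congr rfl fun _ _ => Finset.sum_congr rfl fun _ _ => mul_comm _ _

/-- The operator is triangular in the basis of monomials, with the weights on the diagonal. -/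
theorem traceLT_pow_lower (lam b g : ℂ) (d m : ℕ) :
    traceLT d ((b • opH lam + g • opF lam) ^ m) =
      ∑ j ∈ Finset.range d, (b * (lam - 2 * j)) ^ m := by
  rw [traceLT_apply]
  refine Finset.sum_congr rfl fun j _ => ?_
  have h : ∀ m : ℕ, (∀ i < j, (((b • opH lam + g • opF lam) ^ m) (X ^ j)).coeff i = 0) ∧
      (((b • opH lam + g • opF lam) ^ m) (X ^ j)).coeff j = (b * (lam - 2 * j)) ^ m := by
    intro m
    induction m with
    | zero =>
      refine ⟨fun i hi => ?_, ?_⟩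
      · simp [coeff_X_pow, hi.ne]
      · simp
    | succ m ih =>
      have hF : ∀ i ≤ j,
          (opF lam (((b • opH lam + g • opF lam) ^ m) (X ^ j))).coeff i = 0 := by
        intro i hi
        cases i with
        | zero => exact coeff_opF_zero _ _
        | succ i => rw [coeff_opF_succ, ih.1 i (by omega), mul_zero]
      refine ⟨fun i hi => ?_, ?_⟩
      · rw [pow_succ', Module.End.mul_apply, LinearMap.add_apply, LinearMap.smul_apply,
          LinearMap.smul_apply, coeff_add, coeff_smul, coeff_smul, hF i hi.le, coeff_opH,
          ih.1 i hi]
        simp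
      · rw [pow_succ', Module.End.mul_apply, LinearMap.add_apply, LinearMap.smul_apply,
          LinearMap.smul_apply, coeff_add, coeff_smul, coeff_smul, hF j le_rfl, coeff_opH,
          ih.2, pow_succ']
        simp only [smul_eq_mul]
        ring
  exact (h m).2

theorem traceLT_pow_upper (lam a b : ℂ) (d m : ℕ) :
    traceLT d ((a • opE + b • opH lam) ^ m) =
      ∑ j ∈ Finset.range d, (b * (lam - 2 * j)) ^ m := by
  rw [traceLT_apply]
  refine Finset.sum_congr rfl fun j _ => ?_
  have h : ∀ m : ℕ, (∀ i > j, (((a • opE + b • opH lam) ^ m) (X ^ j)).coeff i = 0) ∧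
      (((a • opE + b • opH lam) ^ m) (X ^ j)).coeff j = (b * (lam - 2 * j)) ^ m := by
    intro m
    induction m with
    | zero =>
      refine ⟨fun i hi => ?_, ?_⟩
      · simp [coeff_X_pow, hi.ne']
      · simp
    | succ m ih =>
      have hE : ∀ i ≥ j, (opE (((a • opE + b • opH lam) ^ m) (X ^ j))).coeff i = 0 := by
        intro i hi
        rw [coeff_opE, ih.1 (i + 1) (by omega), mul_zero]
      refine ⟨fun i hi => ?_, ?_⟩
      · rw [pow_succ', Module.End.mul_apply, LinearMap.add_apply, LinearMap.smul_apply,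
          LinearMap.smul_apply, coeff_add, coeff_smul, coeff_smul, hE i hi.le, coeff_opH,
          ih.1 i hi]
        simp
      · rw [pow_succ', Module.End.mul_apply, LinearMap.add_apply, LinearMap.smul_apply,
          LinearMap.smul_apply, coeff_add, coeff_smul, coeff_smul, hE j le_rfl, coeff_opH,
          ih.2, pow_succ']
        simp only [smul_eq_mul]
        ring
  exact (h m).2

/-- Translation of the variable, as an operator. -/
def translate (t : ℂ) : Module.End ℂ ℂ[X] := taylor t

theorem preservesLT_translate (t : ℂ) (d : ℕ) : PreservesLT d (translate t) := fun p hp => by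
  rw [translate, degree_taylor]
  exact hp

theorem translate_mul_translate_neg (t : ℂ) : translate t * translate (-t) = 1 := by
  refine LinearMap.ext fun p => ?_
  simp [translate, taylor_taylor]

/-- Translation by `t` is the exponential of `t` times `e`, so conjugation by it is the adjoint
action of a unipotent group element. -/
theorem translate_mul_op (lam a b g t : ℂ) :
    translate t * (a • opE + b • opH lam + g • opF lam) =
      ((a - 2 * t * b - t ^ 2 * g) • opE + (b + t * g) • opH lam + g • opF lam) *
        translate t := by
  refine LinearMap.ext fun p => ?_
  have hD : derivative (taylor t p) = taylor t (derivative p) := by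
    simp [taylor_apply, derivative_comp]
  simp only [Module.End.mul_apply, translate, LinearMap.add_apply, LinearMap.smul_apply, map_add,
    opE_apply, opH_apply, opF_apply, hD, map_sub, taylor_mul, taylor_C, taylor_X,
    smul_eq_C_mul, C_mul, C_pow, map_ofNat]
  have h2 : taylor t (2 : ℂ[X]) = 2 := by
    rw [← map_ofNat C 2, taylor_C]
  rw [h2]
  ring

/-- The trace of a power of an element of `sl_2` depends only on its determinant. -/
theorem traceLT_op_pow (d m : ℕ) (a b g : ℂ) :
    traceLT (d + 1) ((a • opE + b • opH d + g • opF d) ^ (2 * m)) =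
      (b ^ 2 + a * g) ^ m * ∑ j ∈ Finset.range (d + 1), ((d : ℂ) - 2 * j) ^ (2 * m) := by
  by_cases hg : g = 0
  · subst hg
    rw [zero_smul, add_zero, traceLT_pow_upper, Finset.mul_sum]
    refine Finset.sum_congr rfl fun j _ => ?_
    rw [mul_pow, mul_zero, add_zero, pow_mul b]
  · obtain ⟨r, hr⟩ := IsAlgClosed.exists_pow_nat_eq (b ^ 2 + a * g) (n := 2) (by norm_num)
    -- This `t` solves the quadratic equation that removes the `e`-component; the diagonal
    -- coefficient becomes the square root `r` of minus the determinant.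
    set t : ℂ := (r - b) / g with ht
    have htg : t * g = r - b := div_mul_cancel₀ _ hg
    have h0 : a - 2 * t * b - t ^ 2 * g = 0 := by
      have : g * (a - 2 * t * b - t ^ 2 * g) = 0 := by
        linear_combination (-2 * b - (t * g + (r - b))) * htg - hr
      exact (mul_eq_zero.1 this).resolve_left hg
    have h1 : b + t * g = r := by rw [htg]; ring
    have hconj := translate_mul_op d a b g t
    rw [h0, h1, zero_smul, zero_add] at hconj
    set A : Module.End ℂ ℂ[X] := a • opE + b • opH d + g • opF d with hA
    set B : Module.End ℂ ℂ[X] := r • opH d + g • opF d with hB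
    have hpow : translate t * A ^ (2 * m) = B ^ (2 * m) * translate t :=
      (SemiconjBy.pow_right hconj (2 * m))
    have hApres : PreservesLT (d + 1) (A ^ (2 * m)) := preservesLT_pow
      ((((preservesLT_opE _).smul a).add ((preservesLT_opH _ _).smul b)).add
        ((preservesLT_opF d).smul g)) _
    have hflip : translate (-t) * translate t = 1 := by
      have := translate_mul_translate_neg (-t)
      rwa [neg_neg] at this
    calc traceLT (d + 1) (A ^ (2 * m))
        = traceLT (d + 1) (translate (-t) * (translate t * A ^ (2 * m))) := by
          rw [← mul_assoc, hflip, one_mul]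
      _ = traceLT (d + 1) (translate t * A ^ (2 * m) * translate (-t)) :=
          traceLT_mul_comm (preservesLT_translate _ _) ((preservesLT_translate _ _).mul hApres)
      _ = traceLT (d + 1) (B ^ (2 * m)) := by
          rw [hpow, mul_assoc, translate_mul_translate_neg, mul_one]
      _ = _ := by
          rw [hB, traceLT_pow_lower, Finset.mul_sum]
          refine Finset.sum_congr rfl fun j _ => ?_
          rw [mul_pow, pow_mul r, hr]

/-! ### The value of the sum of the chord diagrams -/

/-- The trace of `U(sl_2)` in the representation of dimension `d + 1`. -/
def uTrace (d : ℕ) : USlTwo →ₗ[ℂ] ℂ := (traceLT (d + 1)).comp (uRep d).toLinearMap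

theorem sum_smul_orthoGen (y : Fin 3 → ℂ) : ∑ a, y a • orthoGen a =
    (sqrtTwo / 2 * (y 0 - Complex.I * y 1)) • genE + (sqrtTwo / 2 * y 2) • genH +
      (sqrtTwo / 2 * (y 0 + Complex.I * y 1)) • genF := by
  simp only [Fin.sum_univ_three, orthoGen, orthoBasis, Matrix.cons_val_zero, Matrix.cons_val_one,
    Matrix.cons_val, map_smul, map_add, map_sub]
  rw [genE, genH, genF]
  module

theorem uTrace_pow (d n : ℕ) (y : Fin 3 → ℂ) :
    uTrace d ((∑ a, y a • orthoGen a) ^ (2 * n)) =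
      ((1 / 2) ^ n * ∑ j ∈ Finset.range (d + 1), ((d : ℂ) - 2 * j) ^ (2 * n)) *
        (∑ a, y a * y a) ^ n := by
  -- For a traceless matrix, minus the determinant is half the trace of the square.
  have hq : (sqrtTwo / 2 * y 2) ^ 2 + sqrtTwo / 2 * (y 0 - Complex.I * y 1) *
      (sqrtTwo / 2 * (y 0 + Complex.I * y 1)) = 1 / 2 * ∑ a, y a * y a := by
    rw [Fin.sum_univ_three]
    linear_combination ((y 2 ^ 2 + y 0 ^ 2 - Complex.I ^ 2 * y 1 ^ 2) / 4) * sqrtTwo_mul_self -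
      (y 1 ^ 2 / 2) * Complex.I_mul_I
  rw [sum_smul_orthoGen, uTrace, LinearMap.comp_apply, AlgHom.toLinearMap_apply, map_pow]
  simp only [map_add, map_smul, uRep_genE, uRep_genH, uRep_genF]
  rw [traceLT_op_pow, hq, mul_pow]
  ring

/-- Symmetrization is moved to the words, whose symmetrized traces are multiples of the symmetrized
pairing. The remaining contraction of pairings is the factorial. -/
theorem uTrace_chordSum (d n : ℕ) : uTrace d (chordSum n) =
    (1 / 2) ^ n * (∑ j ∈ Finset.range (d + 1), ((d : ℂ) - 2 * j) ^ (2 * n)) *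
      ((2 * n + 1)! : ℂ) := by
  rw [chordSum_eq, sum_sum_perm_smul, map_sum]
  simp only [map_smul, map_sum (uTrace d)]
  simp only [sum_perm_map_word orthoGen (uTrace d) n _ (uTrace_pow d n)]
  rw [← sum_pairDelta_sum_perm, Finset.mul_sum (Finset.univ : Finset (Fin (2 * n) → Fin 3))]
  refine Finset.sum_congr rfl fun p _ => ?_
  rw [smul_eq_mul]
  ring

theorem commute_genE_chordSum (n : ℕ) : Commute genE (chordSum n) := by
  have h : genE = ∑ p, coeffA 0 p • orthoGen p := by
    rw [genE, show slE = basisA 0 from rfl, basisA_eq_sum, map_sum]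
    simp only [map_smul, orthoGen]
  rw [h]
  exact Commute.sum_left _ _ _ fun p _ => (commute_chordSum n p).smul_left _

theorem commute_genF_chordSum (n : ℕ) : Commute genF (chordSum n) := by
  have h : genF = ∑ p, coeffA 2 p • orthoGen p := by
    rw [genF, show slF = basisA 2 from rfl, basisA_eq_sum, map_sum]
    simp only [map_smul, orthoGen]
  rw [h]
  exact Commute.sum_left _ _ _ fun p _ => (commute_chordSum n p).smul_left _

/-- Schur's lemma for the representation of dimension `d + 1`. -/
theorem exists_uRep_eq_smul (d : ℕ) (z : USlTwo) (hE : Commute genE z) (hF : Commute genF z) :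
    ∃ χ : ℂ, ∀ k < d + 1, uRep (d : ℂ) z (X ^ k) = χ • X ^ k := by
  have hE' : ∀ p, opE (uRep (d : ℂ) z p) = uRep (d : ℂ) z (opE p) := fun p => by
    have h := congrArg (uRep (d : ℂ)) hE.eq
    rw [map_mul, map_mul, uRep_genE] at h
    exact LinearMap.congr_fun h p
  have hF' : ∀ p, opF d (uRep (d : ℂ) z p) = uRep (d : ℂ) z (opF d p) := fun p => by
    have h := congrArg (uRep (d : ℂ)) hF.eq
    rw [map_mul, map_mul, uRep_genF] at h
    exact LinearMap.congr_fun h p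
  -- The image of the highest weight vector `1` is killed by `e`, hence constant. The scalar then
  -- propagates along `f`, whose coefficient `d - k` is nonzero below the top degree.
  have h0 : derivative (uRep (d : ℂ) z 1) = 0 := by
    have h := hE' 1
    rwa [opE_apply, opE_apply, derivative_one, map_zero] at h
  have h1 := eq_C_of_natDegree_eq_zero (derivative_eq_zero.1 h0)
  refine ⟨(uRep (d : ℂ) z 1).coeff 0, fun k => ?_⟩
  induction k with
  | zero =>
    intro _
    rw [pow_zero, smul_eq_C_mul, mul_one]
    exact h1
  | succ k ih =>
    intro hk
    have h2 := hF' (X ^ k)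
    rw [ih (by omega), map_smul, opF_X_pow, map_smul, smul_comm] at h2
    have hne : (d : ℂ) - k ≠ 0 := by
      rw [sub_ne_zero]
      exact_mod_cast (show d ≠ k by omega)
    exact (smul_right_injective _ hne h2).symm

theorem casimir_eq : casimir = genE * genF + (1 / 2 : ℂ) • (genH * genH) + genF * genE := by
  simp [casimir, Fin.sum_univ_three, basisA, basisB, genE, genF, genH]

theorem uRep_casimir (lam : ℂ) :
    uRep lam casimir = algebraMap ℂ _ (((lam + 1) ^ 2 - 1) / 2) := by
  refine LinearMap.ext fun p => ?_
  rw [casimir_eq]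
  simp only [map_add, map_smul, map_mul, uRep_genE, uRep_genF, uRep_genH, LinearMap.add_apply,
    LinearMap.smul_apply, Module.End.mul_apply, Module.algebraMap_end_apply, opE_apply, opF_apply,
    opH_apply, smul_eq_C_mul, derivative_mul, derivative_sub, derivative_C, derivative_X,
    derivative_ofNat]
  have h1 : (C (((lam + 1) ^ 2 - 1) / 2) : ℂ[X]) = C (1 / 2) * ((C lam + 1) ^ 2 - 1) := by
    rw [div_eq_inv_mul, C_mul, C_sub, C_pow, C_add, C_1]
    norm_num
  have h2 : (C (1 / 2) : ℂ[X]) * 2 = 1 := by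
    rw [← map_ofNat C 2, ← C_mul]
    norm_num
  rw [h1]
  linear_combination (-(C lam * p + 2 * C lam * X * derivative p - 2 * X * derivative p -
    2 * X * X * derivative (derivative p))) * h2

theorem uRep_aeval_casimir (lam : ℂ) (q : ℂ[X]) (p : ℂ[X]) :
    uRep lam (aeval casimir q) p = (q.eval (((lam + 1) ^ 2 - 1) / 2)) • p := by
  rw [← aeval_algHom_apply, uRep_casimir, aeval_algebraMap_apply, Module.algebraMap_end_apply]
  rfl

/-! ### Bernoulli polynomials and the comparison of scalars -/

theorem bernoulliPoly_eval_one_add (n : ℕ) (x : ℂ) :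
    (bernoulliPoly n).eval (1 + x) = (bernoulliPoly n).eval x + n * x ^ (n - 1) := by
  have h := congrArg (fun r : ℚ[X] => (r.map (algebraMap ℚ ℂ)).eval x)
    (Polynomial.bernoulli_comp_one_add_X n)
  simpa [Polynomial.map_comp, bernoulliPoly] using h

theorem bernoulliPoly_eval_one_sub (n : ℕ) (x : ℂ) :
    (bernoulliPoly n).eval (1 - x) = (-1) ^ n * (bernoulliPoly n).eval x := by
  have h := congrArg (fun r : ℚ[X] => (r.map (algebraMap ℚ ℂ)).eval x)
    (Polynomial.bernoulli_comp_one_sub_X n)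
  simpa [Polynomial.map_comp, bernoulliPoly] using h

/-- The difference equation of the Bernoulli polynomials makes the sum telescope. The weights are
symmetric about zero, so the two boundary arguments add up to `1`, and reflection in odd degree
doubles the boundary term. -/
theorem sum_range_sub_pow (n d : ℕ) :
    (2 * n + 1 : ℂ) * ∑ j ∈ Finset.range (d + 1), ((d : ℂ) - 2 * j) ^ (2 * n) =
      2 ^ (2 * n + 1) * (bernoulliPoly (2 * n + 1)).eval ((1 + ((d : ℂ) + 1)) / 2) := by
  have h1 : ∀ (x : ℂ) (k : ℕ), (2 * n + 1 : ℂ) * ∑ j ∈ Finset.range k, (x - j) ^ (2 * n) =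
      (bernoulliPoly (2 * n + 1)).eval (1 + x) -
        (bernoulliPoly (2 * n + 1)).eval (1 + x - k) := by
    intro x k
    induction k with
    | zero => simp
    | succ k ih =>
      have h := bernoulliPoly_eval_one_add (2 * n + 1) (x - k)
      rw [Finset.sum_range_succ, mul_add, ih]
      rw [show 1 + (x - k) = 1 + x - k by ring, Nat.add_sub_cancel] at h
      rw [h, show 1 + x - ((k + 1 : ℕ) : ℂ) = x - k by push_cast; ring]
      push_cast
      ring
  have h2 := h1 (d / 2) (d + 1)
  have h3 : (1 + (d : ℂ) / 2 - ((d + 1 : ℕ) : ℂ)) = 1 - (1 + (d + 1)) / 2 := by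
    push_cast; ring
  have h4 : 1 + (d : ℂ) / 2 = (1 + (d + 1)) / 2 := by ring
  rw [h3, bernoulliPoly_eval_one_sub, h4] at h2
  have h5 : ∀ j : ℕ, ((d : ℂ) - 2 * j) ^ (2 * n) = 2 ^ (2 * n) * (d / 2 - j) ^ (2 * n) := by
    intro j
    rw [← mul_pow]
    congr 1
    ring
  simp only [h5]
  rw [← Finset.mul_sum, mul_left_comm, h2, Odd.neg_one_pow ⟨n, rfl⟩]
  ring

theorem chordSum_eq_smul_aeval (n : ℕ) :
    chordSum n = (2 ^ n * ((2 * n)! : ℂ) * ((2 * n + 1)! : ℂ)) •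
      aeval casimir (shiftedBernoulli n) := by
  rw [← sub_eq_zero]
  apply eq_zero_of_uRep
  intro d k hk
  obtain ⟨χ, hχ⟩ := exists_uRep_eq_smul d (chordSum n) (commute_genE_chordSum n)
    (commute_genF_chordSum n)
  -- The trace of a scalar on a space of dimension `d + 1`; comparing with the trace already
  -- computed determines `χ`.
  have h1 : uTrace d (chordSum n) = (d + 1) * χ := by
    rw [uTrace, LinearMap.comp_apply, AlgHom.toLinearMap_apply, traceLT_apply,
      Finset.sum_congr rfl fun j hj => by rw [hχ j (Finset.mem_range.1 hj)]]
    simp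
  rw [uTrace_chordSum] at h1
  -- At $x=d+1$ the argument of $q_n$ is the scalar by which the Casimir element acts.
  have h2 := congrArg (fun p : ℂ[X] => p.eval ((d : ℂ) + 1)) (shiftedBernoulli_spec n)
  simp only [eval_mul, eval_X, eval_comp, eval_C, eval_sub, eval_pow, eval_one, eval_add] at h2
  rw [one_div_mul_eq_div, one_div_mul_eq_div] at h2
  have h3 := sum_range_sub_pow n d
  have hd : (d : ℂ) + 1 ≠ 0 := by exact_mod_cast Nat.succ_ne_zero d
  have hfac : ((2 * n + 1)! : ℂ) = (2 * n + 1) * ((2 * n)! : ℂ) := by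
    rw [Nat.factorial_succ]
    push_cast
    ring
  have hfac0 : ((2 * n + 1)! : ℂ) ≠ 0 := by exact_mod_cast Nat.factorial_ne_zero _
  have h4 : χ = (2 ^ n * ((2 * n)! : ℂ) * ((2 * n + 1)! : ℂ)) *
      (shiftedBernoulli n).eval ((((d : ℂ) + 1) ^ 2 - 1) / 2) := by
    apply mul_left_cancel₀ hd
    rw [← h1, mul_left_comm, h2]
    set S := ∑ j ∈ Finset.range (d + 1), ((d : ℂ) - 2 * j) ^ (2 * n)
    set b := (bernoulliPoly (2 * n + 1)).eval ((1 + ((d : ℂ) + 1)) / 2)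
    have h5 : (2 : ℂ) ^ n * (1 / 2) ^ n = 1 := by rw [← mul_pow]; norm_num
    have h6 : ((2 * n + 1)! : ℂ) * (2 / ((2 * n + 1)! : ℂ)) = 2 := mul_div_cancel₀ _ hfac0
    calc (1 / 2) ^ n * S * ((2 * n + 1)! : ℂ)
        = (1 / 2) ^ n * ((2 * n)! : ℂ) * ((2 * n + 1) * S) := by rw [hfac]; ring
      _ = 2 ^ n * ((2 * n)! : ℂ) * 2 * b := by
          rw [h3, pow_succ, show (2 : ℂ) ^ (2 * n) = 2 ^ n * 2 ^ n by rw [← pow_add, two_mul]]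
          linear_combination (2 ^ n * ((2 * n)! : ℂ) * 2 * b) * h5
      _ = _ := by
          linear_combination (-2 ^ n * ((2 * n)! : ℂ) * b) * h6
  rw [map_sub, map_smul, LinearMap.sub_apply, LinearMap.smul_apply, hχ k hk, uRep_aeval_casimir,
    smul_smul, ← h4, sub_self]

end

end SlTwoWheels

open SlTwoWheels in
theorem theorem4p1 (n : ℕ) (hn : 1 ≤ n) :
    (wheel (2 * n)).HasWeight
        ((2 ^ (2 * n + 1) * ((2 * n + 1)! : ℂ)) • Polynomial.aeval casimir (shiftedBernoulli n)) ∧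
      ∑ σ : Equiv.Perm (Fin (2 * n)), chordWeight (permChordDiagram n σ) =
        (2 ^ n * ((2 * n)! : ℂ) * ((2 * n + 1)! : ℂ)) •
          Polynomial.aeval casimir (shiftedBernoulli n) := by
  refine ⟨?_, chordSum_eq_smul_aeval n⟩
  have h := (wheel (2 * n)).hasWeight_trivalentWeight
  rw [trivalentWeight_average_wheel (by omega), chordSum_eq_smul_aeval, smul_smul] at h
  have h0 : ((2 * n)! : ℂ) ≠ 0 := by exact_mod_cast Nat.factorial_ne_zero _
  have h1 : (((2 * n)! : ℂ)⁻¹ * 2 ^ (n + 1)) * (2 ^ n * ((2 * n)! : ℂ) * ((2 * n + 1)! : ℂ)) =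
      2 ^ (2 * n + 1) * ((2 * n + 1)! : ℂ) := by
    rw [show 2 * n + 1 = n + 1 + n by ring, pow_add (2 : ℂ) (n + 1) n]
    field_simp
  rwa [h1] at h
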